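/- Let $m\ge 1$ and let $S$ be a scale function on the symmetric positive definite $m\times m$ real matrices: positive, homogeneous of order one, differentiable with $\partial S(\Sigma)/\partial[\Sigma]_{11}\neq 0$, and $S(I_m)=1$. For a symmetric positive definite matrix $V$ with $S(V)=1$ (a shape matrix) let $\underline{\mathrm{vecs}}(V)$ be the vector of the entries of the lower triangular part of $V$ other than $[V]_{11}$; it determines $V$. Let $\overline{\mathcal G}$ be the set of functions $\bar g:(0,\infty)\to[0,\infty)$ with $$\int_0^\infty t^{m/2-1}\bar g(t)\,dt=\delta_m:=\pi^{-m/2}\Gamma(m/2),\qquad \delta_m^{-1}\int_0^\infty t^{m/2}\bar g(t)\,dt=m .$$ Let $\{\bar g_\zeta:\zeta\in\Delta\}\subset\overline{\mathcal G}$, $\Delta\subseteq\mathbb R^r$, be a family of density generators, and for $\gamma=(\mu,\underline{\mathrm{vecs}}(V))$ and $s>0$ put $$p(x\mid\gamma,s,\zeta)=s^{-m/2}|V|^{-1/2}\,\bar g_\zeta\!\left(s^{-1}(x-\mu)^TV^{-1}(x-\mu)\right),\qquad x\in\mathbb R^m .$$ Fix a true parameter: $\mu_0\in\mathbb R^m$,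 a shape matrix $V_0$, $s_0>0$, and $\zeta_0$ in the interior of $\Delta$; let $\gamma_0=(\mu_0,\underline{\mathrm{vecs}}(V_0))$, let $P_0$ be the law with density $p(\cdot\mid\gamma_0,s_0,\zeta_0)$, and let $\mathcal H$ be the Hilbert space of the zero-mean functions in $L^2(P_0)$. Assume that $\bar g_0=\bar g_{\zeta_0}$ is $C^1$ on $(0,\infty)$ with $$\int_0^\infty \frac{\bar g_0'(t)^2}{\bar g_0(t)}\,t^{m/2+1}\,dt<\infty,\qquad \int_0^\infty \frac{\bar g_0'(t)^2}{\bar g_0(t)}\,t^{m/2}\,dt<\infty$$ (the integrands being read as $0$ where $\bar g_0=0$), and that the scores $\partial\ln p(x\mid\gamma_0,s_0,\zeta)/\partial\zeta_j|_{\zeta=\zeta_0}$, $j=1,\dots,r$, exist $P_0$-almost surely and belong to $\mathcal H$. For a nuisance parameter $\xi$, with true value $\xi_0$, let $s_{\gamma_0}$ and $s_{\xi_0}$ be the vectors of the partial derivatives of $\ln p$ at the true parameter with respect to the components of $\gamma$ and of $\xi$, let $\mathcal T_{\xi_0}\subseteq\mathcal H$ be the linear span of the components of $s_{\xi_0}$,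 and define the efficient Fisher information matrix for $\gamma_0$ in the presence of the nuisance $\xi_0$ by $$\bar I(\gamma_0\mid\xi_0)=E_0\{\bar t\,\bar t^{\,T}\},\qquad \bar t=s_{\gamma_0}-\Pi(s_{\gamma_0}\mid\mathcal T_{\xi_0}),$$ where $\Pi(\cdot\mid\mathcal T_{\xi_0})$ is the (componentwise) orthogonal projection in $\mathcal H$ onto $\mathcal T_{\xi_0}$. Then the scores for $\gamma_0$ and for $s_0$ exist $P_0$-almost surely and belong to $\mathcal H$, and the efficient Fisher information matrix for $\gamma_0$ with nuisance $(s,\zeta)$ (scale unknown, density generator known up to $\zeta$) equals the one with nuisance $s$ alone (scale unknown, density generator $\bar g_{\zeta_0}$ known): $$\bar I(\gamma_0\mid s_0,\zeta_0)=\bar I(\gamma_0\mid s_0).$$ So not knowing $\zeta$ costs no efficiency beyond not knowing $s$. -/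

import Mathlib

open MeasureTheory Set

noncomputable section

/-! ### Parametric models: scores, tangent spaces, efficient Fisher information -/

section Model

variable {X : Type*} [MeasureSpace X] {ι κ : Type*} [DecidableEq ι] [DecidableEq κ]

/-- The law with density `f` with respect to the reference (Lebesgue) measure. -/
def densityLaw (f : X → ℝ) : Measure X :=
  (volume : Measure X).withDensity fun x => ENNReal.ofReal (f x)

/-- `f` is a representative of an element of the Hilbert space `H` of the zero-mean functions of
finite variance under `P`. (Integrability follows from square integrability if `P` is finite.) -/
def IsCentered (P : Measure X) (f : X → ℝ) : Prop :=
  MemLp f 2 P ∧ Integrable f P ∧ ∫ x, f x ∂P = 0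

/-- The Hilbert space `H` of the zero-mean functions of finite variance under `P`, with the
inner product `⟨h₁, h₂⟩ = E[h₁ h₂]` inherited from `L²(P)`. -/
def CenteredL2 (P : Measure X) : Submodule ℝ (Lp ℝ 2 P) where
  carrier := {f | Integrable f P ∧ ∫ x, f x ∂P = 0}
  zero_mem' := by
    have h : ((0 : Lp ℝ 2 P) : X → ℝ) =ᵐ[P] 0 := Lp.coeFn_zero ℝ 2 P
    refine ⟨(integrable_congr h).2 (integrable_zero X ℝ P), ?_⟩
    rw [integral_congr_ae h]
    simp
  add_mem' := by
    rintro f g ⟨hf, hf0⟩ ⟨hg, hg0⟩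
    have h := Lp.coeFn_add f g
    refine ⟨(integrable_congr h).2 (hf.add hg), ?_⟩
    rw [integral_congr_ae h]
    simp [integral_add hf hg, hf0, hg0]
  smul_mem' := by
    rintro c f ⟨hf, hf0⟩
    have h := Lp.coeFn_smul c f
    refine ⟨(integrable_congr h).2 (hf.smul c), ?_⟩
    rw [integral_congr_ae h]
    simp [integral_const_mul, hf0]

open Classical in
/-- The element of `H` represented by `f` (and `0` if `f` does not represent one). -/
def toCentered (P : Measure X) (f : X → ℝ) : CenteredL2 P :=
  if h : IsCentered P f then
    ⟨h.1.toLp f, (integrable_congr h.1.coeFn_toLp).2 h.2.1,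
      (integral_congr_ae h.1.coeFn_toLp).trans h.2.2⟩
  else 0

/-- The `i`-th component `∂ ln p(x | θ) / ∂ θ_i` at `θ = θ₀` of the score vector. -/
def score (p : (ι → ℝ) → X → ℝ) (θ₀ : ι → ℝ) (i : ι) (x : X) : ℝ :=
  deriv (fun t => Real.log (p (Function.update θ₀ i t) x)) (θ₀ i)

/-- The `i`-th score of the model `p` at `θ₀` exists almost surely and belongs to `H`. -/
def HasRegularScore (p : (ι → ℝ) → X → ℝ) (θ₀ : ι → ℝ) (i : ι) : Prop :=
  (∀ᵐ x ∂densityLaw (p θ₀),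
    DifferentiableAt ℝ (fun t => Real.log (p (Function.update θ₀ i t) x)) (θ₀ i)) ∧
  IsCentered (densityLaw (p θ₀)) (score p θ₀ i)

/-- All scores, for the parameter of interest `γ` and for the nuisance parameter `ξ`, of the model
`p(x | γ, ξ)` at `(γ₀, ξ₀)` exist almost surely and belong to `H`. -/
def IsRegularModel (p : (ι → ℝ) → (κ → ℝ) → X → ℝ) (γ₀ : ι → ℝ) (ξ₀ : κ → ℝ) : Prop :=
  (∀ i, HasRegularScore (fun γ => p γ ξ₀) γ₀ i) ∧ (∀ k, HasRegularScore (p γ₀) ξ₀ k)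

/-- The nuisance tangent space: the linear span in `H` of the scores of the nuisance parameter. -/
def nuisanceTangentSpace (p : (ι → ℝ) → (κ → ℝ) → X → ℝ) (γ₀ : ι → ℝ) (ξ₀ : κ → ℝ) :
    Submodule ℝ (CenteredL2 (densityLaw (p γ₀ ξ₀))) :=
  Submodule.span ℝ
    (Set.range fun k => toCentered (densityLaw (p γ₀ ξ₀)) (score (p γ₀) ξ₀ k))

instance nuisanceTangentSpace.hasOrthogonalProjection [Finite κ]
    (p : (ι → ℝ) → (κ → ℝ) → X → ℝ) (γ₀ : ι → ℝ) (ξ₀ : κ → ℝ) :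
    (nuisanceTangentSpace p γ₀ ξ₀).HasOrthogonalProjection :=
  haveI : FiniteDimensional ℝ (nuisanceTangentSpace p γ₀ ξ₀) :=
    FiniteDimensional.span_of_finite ℝ (Set.finite_range _)
  haveI : CompleteSpace (nuisanceTangentSpace p γ₀ ξ₀) := FiniteDimensional.complete ℝ _
  Submodule.HasOrthogonalProjection.ofCompleteSpace _

/-- The efficient score `s_γ₀ - Π(s_γ₀ | T)` for `γ`, componentwise, where `Π(· | T)` is the
orthogonal projection in `H` onto the nuisance tangent space `T`. -/
def efficientScore [Finite κ] (p : (ι → ℝ) → (κ → ℝ) → X → ℝ) (γ₀ : ι → ℝ) (ξ₀ : κ → ℝ) (i : ι) :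
    CenteredL2 (densityLaw (p γ₀ ξ₀)) :=
  toCentered _ (score (fun γ => p γ ξ₀) γ₀ i) -
    (nuisanceTangentSpace p γ₀ ξ₀).starProjection
      (toCentered _ (score (fun γ => p γ ξ₀) γ₀ i))

/-- The efficient Fisher information matrix for `γ₀` in the presence of the nuisance `ξ₀`: the
matrix of the second moments of the efficient score vector under the true law. -/
def efficientFIM [Finite κ] (p : (ι → ℝ) → (κ → ℝ) → X → ℝ) (γ₀ : ι → ℝ) (ξ₀ : κ → ℝ) :
    Matrix ι ι ℝ :=
  Matrix.of fun i j =>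
    ∫ x, (efficientScore p γ₀ ξ₀ i : Lp ℝ 2 (densityLaw (p γ₀ ξ₀))) x *
      (efficientScore p γ₀ ξ₀ j : Lp ℝ 2 (densityLaw (p γ₀ ξ₀))) x ∂densityLaw (p γ₀ ξ₀)

end Model

/-! ### Real elliptically symmetric distributions -/

section RES

/-- The constant `δ_m = π^(-m/2) Γ(m/2)`. -/
def deltaConst (m : ℕ) : ℝ := Real.pi ^ (-((m : ℝ) / 2)) * Real.Gamma ((m : ℝ) / 2)

/-- The set of the density generators in dimension `m`. -/
def densityGenerators (m : ℕ) : Set (ℝ → ℝ) :=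
  {g | (∀ t, 0 < t → 0 ≤ g t) ∧
    IntegrableOn (fun t => t ^ ((m : ℝ) / 2 - 1) * g t) (Ioi 0) ∧
    ∫ t in Ioi (0 : ℝ), t ^ ((m : ℝ) / 2 - 1) * g t = deltaConst m}

/-- The set of the constrained density generators in dimension `m`: those for which the
second-order modular variate `Q` has mean `m`. -/
def constrainedGenerators (m : ℕ) : Set (ℝ → ℝ) :=
  {g | g ∈ densityGenerators m ∧
    IntegrableOn (fun q => q ^ ((m : ℝ) / 2) * g q) (Ioi 0) ∧
    (deltaConst m)⁻¹ * ∫ q in Ioi (0 : ℝ), q ^ ((m : ℝ) / 2) * g q = m}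

/-- The standing regularity of a density generator `g`: it is `C¹` on `(0, ∞)`, and
`E[Q² φ(Q)²]` and `E[Q φ(Q)²]` are finite, where `φ = -2 g' / g` and `Q` has a density
proportional to `q^(m/2-1) g(q)`. -/
structure IsRegularGenerator (m : ℕ) (g : ℝ → ℝ) : Prop where
  contDiffOn : ContDiffOn ℝ 1 g (Ioi 0)
  integrable_alpha :
    IntegrableOn (fun t => t ^ ((m : ℝ) / 2 + 1) * ((g t)⁻¹ * deriv g t ^ 2)) (Ioi 0)
  integrable_beta :
    IntegrableOn (fun t => t ^ ((m : ℝ) / 2) * ((g t)⁻¹ * deriv g t ^ 2)) (Ioi 0)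

variable {m : ℕ} [NeZero m]

/-- The positions of the lower triangular part of an `m × m` matrix other than the top-left one. -/
abbrev LowerIdx (m : ℕ) [NeZero m] : Type :=
  {q : Fin m × Fin m // q.2 ≤ q.1 ∧ q ≠ (0, 0)}

/-- The vector of the entries of the lower triangular part of `A` other than `A 0 0`. -/
def ovecs (A : Matrix (Fin m) (Fin m) ℝ) : LowerIdx m → ℝ := fun k => A k.1.1 k.1.2

/-- The symmetric matrix with top-left entry `a` and remaining lower triangular entries `v`. -/
def symMatrix (a : ℝ) (v : LowerIdx m → ℝ) : Matrix (Fin m) (Fin m) ℝ :=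
  Matrix.of fun i j =>
    if h : (max i j, min i j) = ((0 : Fin m), (0 : Fin m)) then a
    else v ⟨(max i j, min i j), min_le_max, h⟩

/-- `S` is a scale function on the positive definite symmetric matrices: it is positive,
homogeneous of order one, differentiable (as a function of the independent entries) with nonzero
derivative with respect to the top-left entry, and normalized by `S(I) = 1`. -/
structure IsScaleFunction (S : Matrix (Fin m) (Fin m) ℝ → ℝ) : Prop where
  pos : ∀ A : Matrix (Fin m) (Fin m) ℝ, A.PosDef → 0 < S A
  homogeneous : ∀ A : Matrix (Fin m) (Fin m) ℝ, A.PosDef → ∀ c : ℝ, 0 < c → S (c • A) = c * S A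
  differentiable : ∀ (a : ℝ) (v : LowerIdx m → ℝ), (symMatrix a v).PosDef →
    DifferentiableAt ℝ (fun q : ℝ × (LowerIdx m → ℝ) => S (symMatrix q.1 q.2)) (a, v)
  deriv_ne_zero : ∀ (a : ℝ) (v : LowerIdx m → ℝ), (symMatrix a v).PosDef →
    deriv (fun b => S (symMatrix b v)) a ≠ 0
  one : S 1 = 1

/-- The shape matrix `V` with `ovecs V = v`: its top-left entry is the one for which `V` is
positive definite with `S V = 1`. (For a scale function `S`, there is at most one.) -/
def shapeMatrix (S : Matrix (Fin m) (Fin m) ℝ → ℝ) (v : LowerIdx m → ℝ) :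
    Matrix (Fin m) (Fin m) ℝ :=
  symMatrix (Classical.epsilon fun a => (symMatrix a v).PosDef ∧ S (symMatrix a v) = 1) v

/-- The elliptical density `s^(-m/2) |V|^(-1/2) g(s⁻¹ (x-μ)ᵀ V⁻¹ (x-μ))` with location `μ`, shape
matrix `V` determined by its coordinates `ovecs V`, and scale `s`, as a function of
`γ = (μ, ovecs V)`. -/
def resDensity (S : Matrix (Fin m) (Fin m) ℝ → ℝ) (g : ℝ → ℝ)
    (γ : Fin m ⊕ LowerIdx m → ℝ) (s : ℝ) (x : Fin m → ℝ) : ℝ :=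
  let μ : Fin m → ℝ := fun i => γ (Sum.inl i)
  let V : Matrix (Fin m) (Fin m) ℝ := shapeMatrix S fun k => γ (Sum.inr k)
  s ^ (-((m : ℝ) / 2)) * V.det ^ (-(1 / 2 : ℝ)) *
    g (s⁻¹ * dotProduct (x - μ) (V⁻¹.mulVec (x - μ)))

/-- The model with parameter of interest `γ`, nuisance `s`, and known density generator `g`. -/
def modelScale (S : Matrix (Fin m) (Fin m) ℝ → ℝ) (g : ℝ → ℝ) :
    (Fin m ⊕ LowerIdx m → ℝ) → (Unit → ℝ) → (Fin m → ℝ) → ℝ :=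
  fun γ ξ x => resDensity S g γ (ξ ()) x

/-- The model with parameter of interest `γ`, nuisance `(s, ζ)`, and density generator known up to
`ζ`. -/
def modelScaleZeta (S : Matrix (Fin m) (Fin m) ℝ → ℝ) {r : ℕ} (g : (Fin r → ℝ) → ℝ → ℝ) :
    (Fin m ⊕ LowerIdx m → ℝ) → (Unit ⊕ Fin r → ℝ) → (Fin m → ℝ) → ℝ :=
  fun γ ξ x => resDensity S (g fun j => ξ (Sum.inr j)) γ (ξ (Sum.inl ())) x

end RES

end

/-!
The scores for the scale `s` and for `ζ` are functions of the squared radius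
`Q = s₀⁻¹ (x - μ₀)ᵀ V₀⁻¹ (x - μ₀)` alone, and the part of the score for `γ` that depends on the
radius alone, its conditional expectation given `Q`, is a multiple of the score for `s`. So the
projection of the score for `γ` onto the span of the scores for `(s, ζ)` already lies in the span
of the score for `s`: the two efficient scores coincide, and with them the two information matrices
(`efficientFIM_eq_of_inner_eq_zero`).

In detail, write `Σ = s V` and `s₀ V₀ = C Cᵀ`. The map `y ↦ μ₀ + C y` carries the spherical law with
density `g(|y|²)` to the true law (`measurePreserving_locScaleMap`), and in the coordinates `y` the
derivative of the log-density along any path of locations and scatter matrices is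
`f_{A,ℓ}(y) = -tr A / 2 - (g' / g)(|y|²) (yᵀ A y + ℓᵀ y)` (`affineScore`,
`hasDerivAt_log_elliptical`), where `A` is the derivative of the scatter matrix and `ℓ` twice that
of the location. The scale corresponds to `A = I / s₀`, `ℓ = 0`. By symmetry of the spherical law,
`yᵀ A y` may be replaced by `(tr A / m) |y|²`, and `ℓᵀ y` by `0`, under any integral against a
function of the radius, so that `f_{A,ℓ} - (tr A / m) f_{I,0}` is orthogonal to all functions of
the radius (`integral_affineScore_sub_mul_radial`). The two integrability conditions on `g` say
that the scores have finite variance, and an integration by parts gives mean zero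
(`isCentered_affineScore`).

For the scores for the coordinates of `V` to exist at all, the shape matrix has to be a
differentiable function of these coordinates. The equation `S(V) = 1` is differentiable but perhaps
not continuously so; the implicit function exists and is continuous by Rolle's theorem and the
intermediate value theorem, and it is then differentiable
(`IsScaleFunction.differentiableAt_shapeEntry`).
-/

noncomputable section

/-! ### Derivatives of determinants, inverses and quadratic forms along paths of matrices -/

section MatrixPaths
open Matrix Filter Topology

variable {n : Type*}

/-- The derivative of the determinant at the identity is the trace. -/
theorem hasDerivAt_det_of_eq_one [Fintype n] [DecidableEq n]
    {M : ℝ → Matrix n n ℝ} {M' : Matrix n n ℝ} {t₀ : ℝ}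
    (hM : ∀ i j, HasDerivAt (fun t => M t i j) (M' i j) t₀) (h1 : M t₀ = 1) :
    HasDerivAt (fun t => (M t).det) M'.trace t₀ := by
  have key : ∀ σ : Equiv.Perm n, HasDerivAt
      (fun t => ((Equiv.Perm.sign σ : ℤ) : ℝ) * ∏ i, M t (σ i) i)
      (((Equiv.Perm.sign σ : ℤ) : ℝ) *
        ∑ i, (∏ j ∈ Finset.univ.erase i, M t₀ (σ j) j) • M' (σ i) i) t₀ := fun σ =>
    (HasDerivAt.fun_finsetProd fun i _ => hM (σ i) i).const_mul _
  have h := HasDerivAt.fun_sum (u := Finset.univ) fun σ _ => key σ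
  have e : (fun t => (M t).det) = fun t => ∑ σ : Equiv.Perm n,
      ((Equiv.Perm.sign σ : ℤ) : ℝ) * ∏ i, M t (σ i) i := by
    funext t; exact Matrix.det_apply' _
  rw [e]
  refine h.congr_deriv ?_
  rw [h1]
  simp_rw [Finset.mul_sum]
  rw [Finset.sum_comm]
  refine Finset.sum_congr rfl fun i _ => ?_
  -- For each column `i`, the terms add up to a determinant that Cramer's rule evaluates.
  have h2 : ((1 : Matrix n n ℝ).updateCol i (fun k => M' k i)).det = M' i i := by
    rw [← Matrix.cramer_apply]; simp
  rw [Matrix.diag_apply, ← h2, Matrix.det_apply']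
  refine Finset.sum_congr rfl fun σ _ => ?_
  rw [← Finset.mul_prod_erase _ _ (Finset.mem_univ i)]
  have h3 : ∏ j ∈ Finset.univ.erase i, (1 : Matrix n n ℝ).updateCol i (fun k => M' k i) (σ j) j =
      ∏ j ∈ Finset.univ.erase i, (1 : Matrix n n ℝ) (σ j) j :=
    Finset.prod_congr rfl fun j hj => by simp [(Finset.mem_erase.1 hj).1]
  rw [h3, Matrix.updateCol_self, smul_eq_mul, mul_comm (M' (σ i) i)]

theorem hasDerivAt_mul_matrix_entry [Fintype n] {M N : ℝ → Matrix n n ℝ} {M' N' : Matrix n n ℝ}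
    {t₀ : ℝ}
    (hM : ∀ i j, HasDerivAt (fun t => M t i j) (M' i j) t₀)
    (hN : ∀ i j, HasDerivAt (fun t => N t i j) (N' i j) t₀) (i j : n) :
    HasDerivAt (fun t => (M t * N t) i j) ((M' * N t₀ + M t₀ * N') i j) t₀ := by
  simp only [Matrix.mul_apply, Matrix.add_apply, ← Finset.sum_add_distrib]
  exact HasDerivAt.fun_sum fun k _ => (hM i k).mul (hN k j)

theorem continuousAt_matrix_of_hasDerivAt {M : ℝ → Matrix n n ℝ} {M' : Matrix n n ℝ} {t₀ : ℝ}
    (hM : ∀ i j, HasDerivAt (fun t => M t i j) (M' i j) t₀) : ContinuousAt M t₀ :=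
  continuousAt_pi.2 fun i => continuousAt_pi.2 fun j => (hM i j).continuousAt

/-- Jacobi's formula along a path that is differentiable at a point. -/
theorem hasDerivAt_det [Fintype n] [DecidableEq n]
    {M : ℝ → Matrix n n ℝ} {M' : Matrix n n ℝ} {t₀ : ℝ}
    (hM : ∀ i j, HasDerivAt (fun t => M t i j) (M' i j) t₀) (h0 : IsUnit (M t₀).det) :
    HasDerivAt (fun t => (M t).det) ((M t₀).det * ((M t₀)⁻¹ * M').trace) t₀ := by
  have h1 := hasDerivAt_det_of_eq_one (M := fun t => (M t₀)⁻¹ * M t) (M' := (M t₀)⁻¹ * M')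
    (t₀ := t₀) (fun i j => by
      simpa using hasDerivAt_mul_matrix_entry (M := fun _ => (M t₀)⁻¹) (M' := 0)
        (fun i j => hasDerivAt_const _ _) hM i j) (Matrix.nonsing_inv_mul _ h0)
  have h2 := h1.const_mul (M t₀).det
  have e : (fun t => (M t).det) = fun t => (M t₀).det * ((M t₀)⁻¹ * M t).det := by
    funext t
    rw [← Matrix.det_mul, Matrix.mul_nonsing_inv_cancel_left _ _ h0]
  rw [e]
  exact h2

theorem continuousAt_inv_matrix [Fintype n] [DecidableEq n] {M : Matrix n n ℝ} (h0 : IsUnit M.det) :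
    ContinuousAt (Inv.inv : Matrix n n ℝ → Matrix n n ℝ) M :=
  continuousAt_matrix_inv M (by
    rw [Ring.inverse_eq_inv']; exact continuousAt_inv₀ h0.ne_zero)

/-- The derivative of the inverse along a path that is differentiable at a point. -/
theorem hasDerivAt_inv_entry [Fintype n] [DecidableEq n]
    {M : ℝ → Matrix n n ℝ} {M' : Matrix n n ℝ} {t₀ : ℝ}
    (hM : ∀ i j, HasDerivAt (fun t => M t i j) (M' i j) t₀) (h0 : IsUnit (M t₀).det) (i j : n) :
    HasDerivAt (fun t => (M t)⁻¹ i j) (-((M t₀)⁻¹ * M' * (M t₀)⁻¹) i j) t₀ := by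
  have hc := continuousAt_matrix_of_hasDerivAt hM
  have hci : ContinuousAt (fun t => (M t)⁻¹) t₀ :=
    ContinuousAt.comp (g := (Inv.inv : Matrix n n ℝ → Matrix n n ℝ))
      (continuousAt_inv_matrix h0) hc
  have hdet : ∀ᶠ t in 𝓝[≠] t₀, IsUnit (M t).det := by
    have hd : ContinuousAt (fun t => (M t).det) t₀ :=
      ContinuousAt.comp (g := Matrix.det) continuous_id.matrix_det.continuousAt hc
    filter_upwards [(hd.eventually_ne h0.ne_zero).filter_mono nhdsWithin_le_nhds] with t ht
    exact isUnit_iff_ne_zero.2 ht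
  rw [hasDerivAt_iff_tendsto_slope]
  have hs : ∀ k l, Tendsto (slope (fun t => M t k l) t₀) (𝓝[≠] t₀) (𝓝 (M' k l)) := fun k l =>
    hasDerivAt_iff_tendsto_slope.1 (hM k l)
  have hsl : Tendsto (fun t => Matrix.of fun k l => slope (fun t => M t k l) t₀ t) (𝓝[≠] t₀)
      (𝓝 M') := tendsto_pi_nhds.2 fun k => tendsto_pi_nhds.2 fun l => hs k l
  have hprod : Tendsto (fun t => -((M t)⁻¹ * (Matrix.of fun k l => slope (fun t => M t k l) t₀ t) *
      (M t₀)⁻¹)) (𝓝[≠] t₀) (𝓝 (-((M t₀)⁻¹ * M' * (M t₀)⁻¹))) :=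
    (((hci.tendsto.mono_left nhdsWithin_le_nhds).mul hsl).mul tendsto_const_nhds).neg
  have hij := (tendsto_pi_nhds.1 (tendsto_pi_nhds.1 hprod i) j)
  refine hij.congr' ?_
  filter_upwards [hdet] with t ht
  have e : (Matrix.of fun k l => slope (fun t => M t k l) t₀ t) = (t - t₀)⁻¹ • (M t - M t₀) := by
    ext k l; simp [slope_def_field, div_eq_inv_mul]
  have e2 : (M t)⁻¹ * (M t - M t₀) * (M t₀)⁻¹ = -((M t)⁻¹ - (M t₀)⁻¹) := by
    rw [Matrix.mul_sub, Matrix.nonsing_inv_mul _ ht, Matrix.sub_mul, Matrix.one_mul,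
      Matrix.mul_nonsing_inv_cancel_right _ _ h0]
    abel
  rw [e, Matrix.mul_smul, Matrix.smul_mul, e2, slope_def_field]
  simp only [neg_sub, Matrix.neg_apply, Matrix.smul_apply, Matrix.sub_apply, smul_eq_mul]
  ring

theorem hasDerivAt_dotProduct_mulVec [Fintype n] {u v : ℝ → n → ℝ} {N : ℝ → Matrix n n ℝ}
    {u' v' : n → ℝ}
    {N' : Matrix n n ℝ} {t₀ : ℝ} (hu : ∀ i, HasDerivAt (fun t => u t i) (u' i) t₀)
    (hv : ∀ i, HasDerivAt (fun t => v t i) (v' i) t₀)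
    (hN : ∀ i j, HasDerivAt (fun t => N t i j) (N' i j) t₀) :
    HasDerivAt (fun t => u t ⬝ᵥ N t *ᵥ v t)
      (u' ⬝ᵥ N t₀ *ᵥ v t₀ + u t₀ ⬝ᵥ N' *ᵥ v t₀ + u t₀ ⬝ᵥ N t₀ *ᵥ v') t₀ := by
  have h : HasDerivAt (fun t => ∑ i, u t i * ∑ j, N t i j * v t j)
      (∑ i, (u' i * ∑ j, N t₀ i j * v t₀ j +
        u t₀ i * ∑ j, (N' i j * v t₀ j + N t₀ i j * v' j))) t₀ :=
    HasDerivAt.fun_sum fun i _ => (hu i).mul (HasDerivAt.fun_sum fun j _ => (hN i j).mul (hv j))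
  refine h.congr_deriv ?_
  simp only [dotProduct, mulVec, Finset.sum_add_distrib, mul_add]
  ring

/-- Positive definiteness is an open condition among the symmetric matrices. -/
theorem eventually_posDef [Fintype n] {V : Matrix n n ℝ} (hV : V.PosDef) :
    ∀ᶠ M in 𝓝 V, M.IsHermitian → M.PosDef := by
  have hK : IsCompact (Metric.sphere (0 : n → ℝ) 1) := isCompact_sphere _ _
  have hcont : Continuous fun q : Matrix n n ℝ × (n → ℝ) => q.2 ⬝ᵥ q.1 *ᵥ q.2 := by fun_prop
  have h := hK.eventually_forall_of_forall_eventually (x₀ := V)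
    (P := fun M z => 0 < z ⬝ᵥ M *ᵥ z) (fun z hz => by
      have hz0 : z ≠ 0 := by
        rintro rfl; simp at hz
      have : 0 < z ⬝ᵥ V *ᵥ z := by simpa using hV.dotProduct_mulVec_pos hz0
      exact hcont.continuousAt.eventually (lt_mem_nhds this))
  filter_upwards [h] with M hM hH
  refine Matrix.PosDef.of_dotProduct_mulVec_pos hH fun z hz => ?_
  have hn : 0 < ‖z‖ := norm_pos_iff.2 hz
  have h1 := hM (‖z‖⁻¹ • z) (by simp [norm_smul, hn.ne'])
  rw [Matrix.mulVec_smul, smul_dotProduct, dotProduct_smul, smul_smul, smul_eq_mul] at h1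
  have := pos_of_mul_pos_right h1 (by positivity)
  simpa using this

open scoped MatrixOrder ComplexOrder in
theorem exists_mul_transpose_eq [Fintype n] [DecidableEq n] {V : Matrix n n ℝ} (hV : V.PosDef) :
    ∃ C : Matrix n n ℝ, V = C * Cᵀ ∧ IsUnit C.det := by
  obtain ⟨B, hB⟩ := CStarAlgebra.nonneg_iff_eq_star_mul_self.mp hV.posSemidef.nonneg
  refine ⟨Bᵀ, by rw [hB, Matrix.transpose_transpose, Matrix.star_eq_conjTranspose,
    Matrix.conjTranspose_eq_transpose_of_trivial], ?_⟩
  have := hV.det_pos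
  rw [hB, Matrix.det_mul] at this
  rw [Matrix.det_transpose]
  exact isUnit_iff_ne_zero.2 (right_ne_zero_of_mul this.ne')

/-- The score `-tr A / 2 - (g' / g)(|y|²) (yᵀ A y + ℓᵀ y)`, at the standard position `μ = 0`,
`Σ = I` of the elliptical family with generator `g`, in the direction given by the derivative `A`
of the scatter matrix and twice the derivative of the location, `ℓ = 2 μ'`. -/
def affineScore [Fintype n] (g : ℝ → ℝ) (A : Matrix n n ℝ) (ℓ : n → ℝ) (y : n → ℝ) : ℝ :=
  -(1 / 2) * A.trace - (g (y ⬝ᵥ y))⁻¹ * deriv g (y ⬝ᵥ y) * (y ⬝ᵥ A *ᵥ y + ℓ ⬝ᵥ y)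

/-- The score of an elliptical density along a path of locations and scatter matrices
`(x - z(t), M(t))`, in the coordinates `y` in which the true distribution is spherical. -/
theorem hasDerivAt_log_elliptical [Fintype n] [DecidableEq n] {g : ℝ → ℝ} {M : ℝ → Matrix n n ℝ}
    {M' C : Matrix n n ℝ} {z : ℝ → n → ℝ} {z' y : n → ℝ} {t₀ : ℝ}
    (hM : ∀ i j, HasDerivAt (fun t => M t i j) (M' i j) t₀)
    (hz : ∀ i, HasDerivAt (fun t => z t i) (z' i) t₀)
    (hC : IsUnit C.det) (hMC : M t₀ = C * Cᵀ) (hzy : z t₀ = C *ᵥ y)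
    (hg : DifferentiableAt ℝ g (y ⬝ᵥ y)) (hpos : g (y ⬝ᵥ y) ≠ 0) :
    HasDerivAt (fun t => Real.log ((M t).det ^ (-(1 / 2 : ℝ)) * g (z t ⬝ᵥ (M t)⁻¹ *ᵥ z t)))
      (affineScore g (C⁻¹ * M' * C⁻¹ᵀ) (-(2 : ℝ) • (C⁻¹ *ᵥ z')) y) t₀ := by
  have hdet : 0 < (M t₀).det := by
    rw [hMC, Matrix.det_mul, Matrix.det_transpose]
    exact mul_self_pos.2 hC.ne_zero
  have hu : IsUnit (M t₀).det := isUnit_iff_ne_zero.2 hdet.ne'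
  have hinv : (M t₀)⁻¹ = C⁻¹ᵀ * C⁻¹ := by
    rw [hMC, Matrix.mul_inv_rev, Matrix.transpose_nonsing_inv]
  have hCy : C⁻¹ *ᵥ z t₀ = y := by
    rw [hzy, Matrix.mulVec_mulVec, Matrix.nonsing_inv_mul _ hC, Matrix.one_mulVec]
  have hquad : ∀ u v : n → ℝ, u ⬝ᵥ (C⁻¹ᵀ * C⁻¹) *ᵥ v = (C⁻¹ *ᵥ u) ⬝ᵥ (C⁻¹ *ᵥ v) := fun u v => by
    rw [← Matrix.mulVec_mulVec, Matrix.dotProduct_mulVec, Matrix.vecMul_transpose]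
  have hQ : z t₀ ⬝ᵥ (M t₀)⁻¹ *ᵥ z t₀ = y ⬝ᵥ y := by rw [hinv, hquad, hCy]
  have h1 := hasDerivAt_det hM hu
  have h2 := hasDerivAt_dotProduct_mulVec (N' := -((M t₀)⁻¹ * M' * (M t₀)⁻¹)) hz hz
    (hasDerivAt_inv_entry hM hu)
  have h3 := (hQ ▸ hg.hasDerivAt : HasDerivAt g (deriv g (y ⬝ᵥ y)) (z t₀ ⬝ᵥ (M t₀)⁻¹ *ᵥ z t₀)).comp
    t₀ h2
  have hl1 := (h1.rpow_const (p := -(1 / 2 : ℝ)) (Or.inl hdet.ne')).log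
    (Real.rpow_pos_of_pos hdet _).ne'
  have hl2 := h3.log (by simpa [hQ] using hpos)
  have hev : ∀ᶠ t in 𝓝 t₀, Real.log ((M t).det ^ (-(1 / 2 : ℝ)) * g (z t ⬝ᵥ (M t)⁻¹ *ᵥ z t)) =
      Real.log ((M t).det ^ (-(1 / 2 : ℝ))) +
        Real.log ((g ∘ fun t => z t ⬝ᵥ (M t)⁻¹ *ᵥ z t) t) := by
    filter_upwards [h1.continuousAt.eventually (lt_mem_nhds hdet),
      h3.continuousAt.eventually_ne (by simpa [hQ] using hpos)] with t ht1 ht2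
    exact Real.log_mul (Real.rpow_pos_of_pos ht1 _).ne' ht2
  refine ((hl1.add hl2).congr_of_eventuallyEq hev).congr_deriv ?_
  have e1 : ((M t₀)⁻¹ * M').trace = (C⁻¹ * M' * C⁻¹ᵀ).trace := by
    rw [hinv, Matrix.mul_assoc, Matrix.trace_mul_comm]
  have e2 : z t₀ ⬝ᵥ (-((M t₀)⁻¹ * M' * (M t₀)⁻¹)) *ᵥ z t₀ = -(y ⬝ᵥ (C⁻¹ * M' * C⁻¹ᵀ) *ᵥ y) := by
    have : C⁻¹ᵀ * C⁻¹ * M' * (C⁻¹ᵀ * C⁻¹) = C⁻¹ᵀ * ((C⁻¹ * M' * C⁻¹ᵀ) * C⁻¹) := by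
      simp only [Matrix.mul_assoc]
    rw [hinv, this, Matrix.neg_mulVec, dotProduct_neg, ← Matrix.mulVec_mulVec,
      ← Matrix.mulVec_mulVec, hCy, Matrix.dotProduct_mulVec, Matrix.vecMul_transpose, hCy]
  have e3 : z' ⬝ᵥ (M t₀)⁻¹ *ᵥ z t₀ = (C⁻¹ *ᵥ z') ⬝ᵥ y := by rw [hinv, hquad, hCy]
  have e4 : z t₀ ⬝ᵥ (M t₀)⁻¹ *ᵥ z' = (C⁻¹ *ᵥ z') ⬝ᵥ y := by
    rw [hinv, hquad, hCy, dotProduct_comm]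
  have e5 : (M t₀).det * (C⁻¹ * M' * C⁻¹ᵀ).trace * -(1 / 2) * (M t₀).det ^ (-(1 / 2 : ℝ) - 1) /
      (M t₀).det ^ (-(1 / 2 : ℝ)) = -(1 / 2) * (C⁻¹ * M' * C⁻¹ᵀ).trace := by
    rw [Real.rpow_sub_one hdet.ne']
    have := (Real.rpow_pos_of_pos hdet (-(1 / 2 : ℝ))).ne'
    field_simp
  simp only [Function.comp_apply, e1, e2, e3, e4, hQ, e5, affineScore, smul_dotProduct, smul_eq_mul]
  field_simp
  ring

end MatrixPaths

/-! ### The shape matrix as a differentiable function of its coordinates -/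

section ShapeMatrix
open Filter Topology

/-- An implicit function is differentiable as soon as it is continuous, for an equation that is
differentiable at the point only. -/
theorem differentiableAt_of_implicit {E : Type*} [NormedAddCommGroup E] [NormedSpace ℝ E]
    {F : ℝ × E → ℝ} {α : E → ℝ} {v₀ : E} {c : ℝ} (hF : DifferentiableAt ℝ F (α v₀, v₀))
    (hA : deriv (fun a => F (a, v₀)) (α v₀) ≠ 0) (hα : ContinuousAt α v₀)
    (hc : ∀ᶠ v in 𝓝 v₀, F (α v, v) = c) : DifferentiableAt ℝ α v₀ := by
  set L := fderiv ℝ F (α v₀, v₀) with hL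
  have hd : HasDerivAt (fun a => F (a, v₀)) (L (1, 0)) (α v₀) :=
    hF.hasFDerivAt.comp_hasDerivAt (α v₀) ((hasDerivAt_id _).prodMk (hasDerivAt_const _ _))
  rw [hd.deriv] at hA
  set A := L (1, 0)
  let B : E →L[ℝ] ℝ := L.comp (ContinuousLinearMap.inr ℝ ℝ E)
  have hdec : ∀ (d : ℝ) (w : E), L (d, w) = d * A + B w := fun d w => by
    have : ((d, w) : ℝ × E) = d • (1, 0) + (0, w) := by simp
    rw [this, map_add, map_smul]; rfl
  have hcont : Tendsto (fun v => (α v, v)) (𝓝 v₀) (𝓝 (α v₀, v₀)) :=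
    hα.prodMk continuousAt_id
  have ho : (fun v => F (α v, v) - F (α v₀, v₀) - L ((α v, v) - (α v₀, v₀))) =o[𝓝 v₀]
      fun v => (α v, v) - (α v₀, v₀) := hF.hasFDerivAt.isLittleO.comp_tendsto hcont
  have ho2 : (fun v => α v - α v₀ - (-(A⁻¹ • B)) (v - v₀)) =o[𝓝 v₀]
      fun v => (α v, v) - (α v₀, v₀) := by
    refine (ho.const_mul_left (-A⁻¹)).congr' ?_ (Eventually.of_forall fun _ => rfl)
    filter_upwards [hc] with v hv
    rw [hv, hc.self_of_nhds, Prod.mk_sub_mk, hdec]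
    simp only [neg_apply, smul_apply, smul_eq_mul]
    field_simp
    ring
  -- The remainder is at most half of `|α v - α v₀| + ‖v - v₀‖` near `v₀`, and the first summand can
  -- be absorbed, so that `α v - α v₀ = O(v - v₀)`.
  have hO : (fun v => (α v, v) - (α v₀, v₀)) =O[𝓝 v₀] fun v => v - v₀ := by
    rw [Asymptotics.isBigO_iff]
    refine ⟨2 * ‖A⁻¹ • B‖ + 2, ?_⟩
    filter_upwards [ho2.bound (show (0 : ℝ) < 1 / 2 by norm_num)] with v hv
    have hB := (A⁻¹ • B).le_opNorm (v - v₀)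
    rw [Prod.mk_sub_mk, Prod.norm_def] at hv ⊢
    simp only [neg_apply, sub_neg_eq_add] at hv
    have h1 : ‖α v - α v₀‖ ≤ ‖α v - α v₀ + (A⁻¹ • B) (v - v₀)‖ + ‖(A⁻¹ • B) (v - v₀)‖ := by
      simpa using norm_sub_le (α v - α v₀ + (A⁻¹ • B) (v - v₀)) ((A⁻¹ • B) (v - v₀))
    have hw := norm_nonneg (v - v₀)
    have hK := mul_nonneg (norm_nonneg (A⁻¹ • B)) hw
    have h2 : max ‖α v - α v₀‖ ‖v - v₀‖ ≤ ‖α v - α v₀‖ + ‖v - v₀‖ :=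
      max_le (by linarith) (by linarith [norm_nonneg (α v - α v₀)])
    have h3 : ‖α v - α v₀‖ ≤ (2 * ‖A⁻¹ • B‖ + 2) * ‖v - v₀‖ := by
      linarith
    exact max_le h3 (by linarith)
  exact (HasFDerivAt.of_isLittleO (ho2.trans_isBigO hO)).differentiableAt

variable {m : ℕ} [NeZero m]

theorem symMatrix_isHermitian (a : ℝ) (v : LowerIdx m → ℝ) : (symMatrix a v).IsHermitian := by
  ext i j
  simp only [symMatrix, Matrix.conjTranspose_apply, Matrix.of_apply, star_trivial, max_comm j i,
    min_comm j i]

theorem symMatrix_ovecs {V : Matrix (Fin m) (Fin m) ℝ} (hV : V.IsHermitian) :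
    symMatrix (V 0 0) (ovecs V) = V := by
  ext i j
  by_cases h : (max i j, min i j) = ((0 : Fin m), (0 : Fin m))
  · have h1 : max i j = 0 := congrArg Prod.fst h
    have hi : i = 0 := le_antisymm (h1 ▸ le_max_left i j) (Fin.zero_le _)
    have hj : j = 0 := le_antisymm (h1 ▸ le_max_right i j) (Fin.zero_le _)
    simp [symMatrix, hi, hj]
  · simp only [symMatrix, Matrix.of_apply, h, dite_false, ovecs]
    rcases le_total i j with hij | hij
    · simpa [max_eq_right hij, min_eq_left hij] using hV.apply i j
    · simp [max_eq_left hij, min_eq_right hij]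

theorem symMatrix_add (a b : ℝ) (v : LowerIdx m → ℝ) :
    symMatrix (a + b) v = symMatrix a v + Matrix.diagonal (Pi.single 0 b) := by
  ext i j
  by_cases h : (max i j, min i j) = ((0 : Fin m), (0 : Fin m))
  · have h1 : max i j = 0 := congrArg Prod.fst h
    have hi : i = 0 := le_antisymm (h1 ▸ le_max_left i j) (Fin.zero_le _)
    have hj : j = 0 := le_antisymm (h1 ▸ le_max_right i j) (Fin.zero_le _)
    simp [symMatrix, hi, hj]
  · have hd : Matrix.diagonal (Pi.single (0 : Fin m) b) i j = 0 := by
      by_cases hij : i = j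
      · subst hij
        have : i ≠ 0 := by rintro rfl; simp at h
        simp [this]
      · simp [hij]
    simp only [symMatrix, Matrix.of_apply, Matrix.add_apply, h, dite_false, hd, add_zero]

theorem symMatrix_posDef_mono {a b : ℝ} (hab : a ≤ b) {v : LowerIdx m → ℝ}
    (ha : (symMatrix a v).PosDef) : (symMatrix b v).PosDef := by
  have : b = a + (b - a) := by ring
  rw [this, symMatrix_add]
  refine ha.add_posSemidef (Matrix.PosSemidef.diagonal fun i => ?_)
  by_cases hi : i = 0
  · subst hi; simpa using hab
  · simp [hi]

theorem continuous_symMatrix :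
    Continuous fun q : ℝ × (LowerIdx m → ℝ) => symMatrix q.1 q.2 := by
  refine continuous_pi fun i => continuous_pi fun j => ?_
  by_cases h : (max i j, min i j) = ((0 : Fin m), (0 : Fin m))
  · simp only [symMatrix, Matrix.of_apply, h, dite_true]; fun_prop
  · simp only [symMatrix, Matrix.of_apply, h, dite_false]; fun_prop

theorem eventually_symMatrix_posDef {a : ℝ} {v : LowerIdx m → ℝ} (h : (symMatrix a v).PosDef) :
    ∀ᶠ q : ℝ × (LowerIdx m → ℝ) in 𝓝 (a, v), (symMatrix q.1 q.2).PosDef := by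
  have := (continuous_symMatrix.continuousAt (x := (a, v))).eventually (eventually_posDef h)
  filter_upwards [this] with q hq using hq (symMatrix_isHermitian _ _)

variable {S : Matrix (Fin m) (Fin m) ℝ → ℝ}

theorem IsScaleFunction.continuousAt (hS : IsScaleFunction S) {a : ℝ} {v : LowerIdx m → ℝ}
    (h : (symMatrix a v).PosDef) : ContinuousAt (fun b => S (symMatrix b v)) a :=
  ContinuousAt.comp (g := fun q : ℝ × (LowerIdx m → ℝ) => S (symMatrix q.1 q.2))
    (f := fun b => (b, v)) (hS.differentiable a v h).continuousAt (by fun_prop)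

/-- By Rolle's theorem, a scale function determines the top-left entry of a positive definite
matrix from its other entries. -/
theorem IsScaleFunction.eq_of_eq (hS : IsScaleFunction S) {a b : ℝ} {v : LowerIdx m → ℝ}
    (ha : (symMatrix a v).PosDef) (hb : (symMatrix b v).PosDef)
    (h : S (symMatrix a v) = S (symMatrix b v)) : a = b := by
  wlog hab : a ≤ b generalizing a b
  · exact (this hb ha h.symm (le_of_not_ge hab)).symm
  by_contra hne
  obtain ⟨c, hc, hc0⟩ := exists_deriv_eq_zero (f := fun b => S (symMatrix b v))
    (lt_of_le_of_ne hab hne)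
    (fun x hx => (hS.continuousAt (symMatrix_posDef_mono hx.1 ha)).continuousWithinAt) h
  exact hS.deriv_ne_zero c v (symMatrix_posDef_mono hc.1.le ha) hc0

/-- The top-left entry of the shape matrix with coordinates `v`, an arbitrary number if there is no
such shape matrix. -/
def shapeEntry (S : Matrix (Fin m) (Fin m) ℝ → ℝ) (v : LowerIdx m → ℝ) : ℝ :=
  Classical.epsilon fun a => (symMatrix a v).PosDef ∧ S (symMatrix a v) = 1

theorem IsScaleFunction.shapeEntry_eq (hS : IsScaleFunction S) {a : ℝ} {v : LowerIdx m → ℝ}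
    (ha : (symMatrix a v).PosDef) (h : S (symMatrix a v) = 1) : shapeEntry S v = a := by
  have hex := Classical.epsilon_spec
    (p := fun a => (symMatrix a v).PosDef ∧ S (symMatrix a v) = 1) ⟨a, ha, h⟩
  exact hS.eq_of_eq hex.1 ha (hex.2.trans h.symm)

theorem IsScaleFunction.shapeMatrix_ovecs (hS : IsScaleFunction S) {V : Matrix (Fin m) (Fin m) ℝ}
    (hV : V.PosDef) (h : S V = 1) : shapeMatrix S (ovecs V) = V := by
  have e := symMatrix_ovecs hV.1
  have := hS.shapeEntry_eq (a := V 0 0) (v := ovecs V) (by rwa [e]) (by rwa [e])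
  change symMatrix (shapeEntry S (ovecs V)) (ovecs V) = V
  rw [this, e]

/-- Near the coordinates of a shape matrix, the intermediate value theorem yields shape matrices
with top-left entries close to the given one. -/
theorem IsScaleFunction.eventually_shapeEntry (hS : IsScaleFunction S) {a₀ : ℝ}
    {v₀ : LowerIdx m → ℝ} (ha : (symMatrix a₀ v₀).PosDef) (h : S (symMatrix a₀ v₀) = 1)
    {ε : ℝ} (hε : 0 < ε) :
    ∀ᶠ v in 𝓝 v₀, |shapeEntry S v - a₀| < ε ∧ S (symMatrix (shapeEntry S v) v) = 1 := by
  have hposa : ∀ᶠ a in 𝓝 a₀, (symMatrix a v₀).PosDef :=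
    (Continuous.prodMk continuous_id continuous_const).continuousAt.eventually
      (eventually_symMatrix_posDef ha)
  obtain ⟨η, hη, hball⟩ := Metric.eventually_nhds_iff.1 hposa
  set δ := min (ε / 2) (η / 2)
  have hδ : 0 < δ := by positivity
  have hδε : δ ≤ ε / 2 := min_le_left _ _
  have hδη : δ ≤ η / 2 := min_le_right _ _
  have hlow : (symMatrix (a₀ - δ) v₀).PosDef :=
    hball (by rw [Real.dist_eq]; simp [abs_of_pos hδ]; linarith)
  have hup : (symMatrix (a₀ + δ) v₀).PosDef := symMatrix_posDef_mono (by linarith) hlow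
  have hIcc : ∀ {v : LowerIdx m → ℝ}, (symMatrix (a₀ - δ) v).PosDef →
      ContinuousOn (fun b => S (symMatrix b v)) (Icc (a₀ - δ) (a₀ + δ)) := fun hv x hx =>
    (hS.continuousAt (symMatrix_posDef_mono hx.1 hv)).continuousWithinAt
  -- By injectivity, `S - 1` has opposite signs at the two ends, and keeps them for `v` near `v₀`.
  have hinj : InjOn (fun b => S (symMatrix b v₀)) (Icc (a₀ - δ) (a₀ + δ)) := fun x hx y hy hxy =>
    hS.eq_of_eq (symMatrix_posDef_mono hx.1 hlow) (symMatrix_posDef_mono hy.1 hlow) hxy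
  have hl : ContinuousAt (fun v => S (symMatrix (a₀ - δ) v)) v₀ :=
    ContinuousAt.comp (g := fun q : ℝ × (LowerIdx m → ℝ) => S (symMatrix q.1 q.2))
      (f := fun v => (a₀ - δ, v)) (hS.differentiable _ _ hlow).continuousAt (by fun_prop)
  have hu : ContinuousAt (fun v => S (symMatrix (a₀ + δ) v)) v₀ :=
    ContinuousAt.comp (g := fun q : ℝ × (LowerIdx m → ℝ) => S (symMatrix q.1 q.2))
      (f := fun v => (a₀ + δ, v)) (hS.differentiable _ _ hup).continuousAt (by fun_prop)
  have hposv : ∀ᶠ v in 𝓝 v₀, (symMatrix (a₀ - δ) v).PosDef :=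
    (Continuous.prodMk continuous_const continuous_id).continuousAt.eventually
      (eventually_symMatrix_posDef hlow)
  have m1 : a₀ - δ ∈ Icc (a₀ - δ) (a₀ + δ) := ⟨le_rfl, by linarith⟩
  have m2 : a₀ ∈ Icc (a₀ - δ) (a₀ + δ) := ⟨by linarith, by linarith⟩
  have m3 : a₀ + δ ∈ Icc (a₀ - δ) (a₀ + δ) := ⟨by linarith, le_rfl⟩
  have hroot : ∀ {v : LowerIdx m → ℝ}, (symMatrix (a₀ - δ) v).PosDef →
      (1 : ℝ) ∈ (fun b => S (symMatrix b v)) '' Icc (a₀ - δ) (a₀ + δ) →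
      |shapeEntry S v - a₀| < ε ∧ S (symMatrix (shapeEntry S v) v) = 1 := by
    rintro v hv ⟨a, haI, ha1⟩
    rw [hS.shapeEntry_eq (symMatrix_posDef_mono haI.1 hv) ha1]
    refine ⟨?_, ha1⟩
    rw [abs_lt]
    constructor <;> linarith [haI.1, haI.2]
  rcases (hIcc hlow).strictMonoOn_of_injOn_Icc' (by linarith) hinj with hm | hm
  · have h1 := hm m1 m2 (by linarith)
    have h2 := hm m2 m3 (by linarith)
    simp only [h] at h1 h2
    filter_upwards [hposv, hl.eventually (gt_mem_nhds h1), hu.eventually (lt_mem_nhds h2)]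
      with v hv hv1 hv2
    exact hroot hv (intermediate_value_Icc (by linarith) (hIcc hv) ⟨hv1.le, hv2.le⟩)
  · have h1 := hm m1 m2 (by linarith)
    have h2 := hm m2 m3 (by linarith)
    simp only [h] at h1 h2
    filter_upwards [hposv, hl.eventually (lt_mem_nhds h1), hu.eventually (gt_mem_nhds h2)]
      with v hv hv1 hv2
    exact hroot hv (intermediate_value_Icc' (by linarith) (hIcc hv) ⟨hv2.le, hv1.le⟩)

/-- The implicit function given by `S(V) = 1` is differentiable, although `S` is not assumed to be
continuously differentiable. -/
theorem IsScaleFunction.differentiableAt_shapeEntry (hS : IsScaleFunction S)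
    {V : Matrix (Fin m) (Fin m) ℝ} (hV : V.PosDef) (h : S V = 1) :
    DifferentiableAt ℝ (shapeEntry S) (ovecs V) := by
  have e := symMatrix_ovecs hV.1
  have hV' : (symMatrix (V 0 0) (ovecs V)).PosDef := by rwa [e]
  have h' : S (symMatrix (V 0 0) (ovecs V)) = 1 := by rwa [e]
  have e0 := hS.shapeEntry_eq hV' h'
  refine differentiableAt_of_implicit (F := fun q => S (symMatrix q.1 q.2)) (c := 1) ?_ ?_ ?_ ?_
  · rw [e0]; exact hS.differentiable _ _ hV'
  · rw [e0]; exact hS.deriv_ne_zero _ _ hV'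
  · rw [Metric.continuousAt_iff']
    intro ε hε
    filter_upwards [hS.eventually_shapeEntry hV' h' hε] with v hv
    rw [e0, Real.dist_eq]; exact hv.1
  · filter_upwards [hS.eventually_shapeEntry hV' h' one_pos] with v hv using hv.2

/-- The shape matrix is a differentiable function of each of its coordinates. -/
theorem IsScaleFunction.exists_hasDerivAt_shapeMatrix (hS : IsScaleFunction S)
    {V : Matrix (Fin m) (Fin m) ℝ} (hV : V.PosDef) (h : S V = 1) (k : LowerIdx m) :
    ∃ V' : Matrix (Fin m) (Fin m) ℝ, ∀ i j, HasDerivAt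
      (fun t => shapeMatrix S (Function.update (ovecs V) k t) i j) (V' i j) (ovecs V k) := by
  have hupd : HasDerivAt (fun t => Function.update (ovecs V) k t) (Pi.single k (1 : ℝ))
      (ovecs V k) := hasDerivAt_update _ _ _
  have hα : DifferentiableAt ℝ (fun t => shapeEntry S (Function.update (ovecs V) k t))
      (ovecs V k) := by
    refine DifferentiableAt.comp (g := shapeEntry S) (ovecs V k) ?_ hupd.differentiableAt
    rw [Function.update_eq_self]
    exact hS.differentiableAt_shapeEntry hV h
  have hd : ∀ i j, DifferentiableAt ℝ
      (fun t => shapeMatrix S (Function.update (ovecs V) k t) i j) (ovecs V k) := by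
    intro i j
    change DifferentiableAt ℝ (fun t => symMatrix
      (shapeEntry S (Function.update (ovecs V) k t)) (Function.update (ovecs V) k t) i j) _
    by_cases h : (max i j, min i j) = ((0 : Fin m), (0 : Fin m))
    · simpa only [symMatrix, Matrix.of_apply, h, dite_true] using hα
    · simp only [symMatrix, Matrix.of_apply, h, dite_false]
      exact (hasDerivAt_pi.1 hupd _).differentiableAt
  exact ⟨Matrix.of fun i j => _, fun i j => (hd i j).hasDerivAt⟩

end ShapeMatrix

/-! ### Radial integrals and spherical symmetry -/

section Spherical
open Filter Topology

variable {m : ℕ}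

theorem dotProduct_self_pos {y : Fin m → ℝ} (hy : y ≠ 0) : 0 < y ⬝ᵥ y :=
  lt_of_le_of_ne (Finset.sum_nonneg fun i _ => mul_self_nonneg (y i))
    fun h => hy (dotProduct_self_eq_zero.1 h.symm)

theorem abs_mul_le_dotProduct_self (y : Fin m → ℝ) (i j : Fin m) : |y i * y j| ≤ y ⬝ᵥ y := by
  have h : ∀ k, y k ^ 2 ≤ y ⬝ᵥ y := fun k => by
    rw [sq]
    exact Finset.single_le_sum (f := fun k => y k * y k) (fun i _ => mul_self_nonneg (y i))
      (Finset.mem_univ k)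
  rw [abs_mul]
  nlinarith [h i, h j, sq_abs (y i), sq_abs (y j), sq_nonneg (|y i| - |y j|)]

theorem norm_sq_eq_dotProduct_ofLp (x : EuclideanSpace ℝ (Fin m)) :
    x.ofLp ⬝ᵥ x.ofLp = ‖x‖ ^ (2 : ℝ) := by
  rw [Real.rpow_two, EuclideanSpace.real_norm_sq_eq]
  exact Finset.sum_congr rfl fun i _ => (sq (x.ofLp i)).symm

theorem measurableEmbedding_ofLp :
    MeasurableEmbedding (WithLp.ofLp : EuclideanSpace ℝ (Fin m) → (Fin m → ℝ)) :=
  (PiLp.homeomorph 2 (fun _ : Fin m => ℝ)).measurableEmbedding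

theorem rpow_radial_exponent [NeZero m] {r : ℝ} (hr : 0 < r) (F : ℝ → ℝ) :
    r ^ ((2 : ℝ) - 1) * ((r ^ (2 : ℝ)) ^ ((m : ℝ) / 2 - 1) * F (r ^ (2 : ℝ))) =
      r ^ (m - 1) * F (r ^ (2 : ℝ)) := by
  have hm : ((m - 1 : ℕ) : ℝ) = m - 1 := by
    rw [Nat.cast_sub (NeZero.one_le), Nat.cast_one]
  rw [← mul_assoc, ← Real.rpow_mul hr.le, ← Real.rpow_add hr, ← Real.rpow_natCast, hm]
  congr 2
  ring

/-- Polar coordinates, with the squared radius as a variable: integrability. -/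
theorem integrable_radial_iff [NeZero m] (F : ℝ → ℝ) :
    Integrable (fun y : Fin m → ℝ => F (y ⬝ᵥ y)) ↔
      IntegrableOn (fun t => t ^ ((m : ℝ) / 2 - 1) * F t) (Ioi 0) := by
  have : Nontrivial (EuclideanSpace ℝ (Fin m)) := by
    have : Nonempty (Fin m) := ⟨0⟩
    infer_instance
  rw [← (PiLp.volume_preserving_ofLp (Fin m)).integrable_comp_emb measurableEmbedding_ofLp]
  have e : (fun y : Fin m → ℝ => F (y ⬝ᵥ y)) ∘ (WithLp.ofLp : EuclideanSpace ℝ (Fin m) → _) =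
      fun x => (fun r : ℝ => F (r ^ (2 : ℝ))) ‖x‖ := by
    funext x; simp only [Function.comp_apply, norm_sq_eq_dotProduct_ofLp]
  rw [e, integrable_fun_norm_addHaar volume (f := fun r : ℝ => F (r ^ (2 : ℝ))),
    
    ← integrableOn_Ioi_comp_rpow_iff' (fun t => t ^ ((m : ℝ) / 2 - 1) * F t) (two_ne_zero (α := ℝ)),
    finrank_euclideanSpace, Fintype.card_fin]
  refine integrableOn_congr_fun (fun r hr => ?_) measurableSet_Ioi
  simpa only [smul_eq_mul] using (rpow_radial_exponent (m := m) (mem_Ioi.1 hr) F).symm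

/-- Polar coordinates, with the squared radius as a variable. The value of the constant, which is
`1 / δ_m`, is of no importance for the vanishing of integrals. -/
theorem exists_integral_radial (m : ℕ) [NeZero m] :
    ∃ c : ℝ, ∀ F : ℝ → ℝ, ∫ y : Fin m → ℝ, F (y ⬝ᵥ y) =
      c * ∫ t in Ioi (0 : ℝ), t ^ ((m : ℝ) / 2 - 1) * F t := by
  have : Nontrivial (EuclideanSpace ℝ (Fin m)) := by
    have : Nonempty (Fin m) := ⟨0⟩
    infer_instance
  refine ⟨m * volume.real (Metric.ball (0 : EuclideanSpace ℝ (Fin m)) 1) * 2⁻¹, fun F => ?_⟩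
  rw [← (PiLp.volume_preserving_ofLp (Fin m)).integral_comp measurableEmbedding_ofLp]
  simp only [norm_sq_eq_dotProduct_ofLp]
  rw [integral_fun_norm_addHaar volume (f := fun r : ℝ => F (r ^ (2 : ℝ))),
    finrank_euclideanSpace, Fintype.card_fin, mul_assoc, nsmul_eq_mul, smul_eq_mul, mul_assoc]
  congr 2
  rw [← integral_comp_rpow_Ioi_of_pos (g := fun t => t ^ ((m : ℝ) / 2 - 1) * F t)
    (two_pos (α := ℝ)), ← integral_const_mul]
  refine setIntegral_congr_fun measurableSet_Ioi fun r hr => ?_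
  simp only [smul_eq_mul]
  rw [← rpow_radial_exponent (m := m) (mem_Ioi.1 hr) F]
  ring

/-- The reflection of the `i`-th coordinate. -/
def flipCoord (i : Fin m) (y : Fin m → ℝ) : Fin m → ℝ := fun k => (if k = i then -1 else 1) * y k

theorem flipCoord_involutive (i : Fin m) : Function.Involutive (flipCoord i) := fun y => by
  funext k
  by_cases h : k = i <;> simp [flipCoord, h]

theorem flipCoord_dotProduct_self (i : Fin m) (y : Fin m → ℝ) :
    flipCoord i y ⬝ᵥ flipCoord i y = y ⬝ᵥ y := by
  refine Finset.sum_congr rfl fun k _ => ?_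
  by_cases h : k = i <;> simp [flipCoord, h]

theorem measurable_flipCoord (i : Fin m) : Measurable (flipCoord i) := by
  unfold flipCoord; fun_prop

theorem measurableEmbedding_flipCoord (i : Fin m) : MeasurableEmbedding (flipCoord i) :=
  (⟨(flipCoord_involutive i).toPerm, measurable_flipCoord i, measurable_flipCoord i⟩ :
    (Fin m → ℝ) ≃ᵐ (Fin m → ℝ)).measurableEmbedding

theorem measurePreserving_flipCoord (i : Fin m) : MeasurePreserving (flipCoord i) := by
  refine volume_preserving_pi (f := fun k (x : ℝ) => (if k = i then -1 else 1) * x) fun k => ?_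
  by_cases h : k = i
  · simpa [h] using Measure.measurePreserving_neg (volume : Measure ℝ)
  · simpa [h] using! MeasurePreserving.id (volume : Measure ℝ)

theorem integral_radial_mul_mul_of_ne (K : ℝ → ℝ) {i j : Fin m} (hij : i ≠ j) :
    ∫ y : Fin m → ℝ, K (y ⬝ᵥ y) * (y i * y j) = 0 := by
  have h := (measurePreserving_flipCoord i).integral_comp (measurableEmbedding_flipCoord i)
    (fun y => K (y ⬝ᵥ y) * (y i * y j))
  simp only [flipCoord_dotProduct_self] at h
  simp only [flipCoord, if_true, hij.symm, if_false, one_mul, neg_mul, mul_neg, integral_neg] at h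
  linarith

theorem integral_radial_mul_mul_self (K : ℝ → ℝ) (i j : Fin m) :
    ∫ y : Fin m → ℝ, K (y ⬝ᵥ y) * (y i * y i) = ∫ y : Fin m → ℝ, K (y ⬝ᵥ y) * (y j * y j) := by
  let e := Equiv.swap i j
  have h := (volume_measurePreserving_piCongrLeft (fun _ : Fin m => ℝ) e).integral_comp
    (MeasurableEquiv.measurableEmbedding _) (fun y => K (y ⬝ᵥ y) * (y j * y j))
  have he : ∀ (y : Fin m → ℝ) k, MeasurableEquiv.piCongrLeft (fun _ : Fin m => ℝ) e y (e k) = y k :=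
    fun y k => Equiv.piCongrLeft_apply_apply (fun _ : Fin m => ℝ) e y k
  have hd : ∀ y : Fin m → ℝ, MeasurableEquiv.piCongrLeft (fun _ : Fin m => ℝ) e y ⬝ᵥ
      MeasurableEquiv.piCongrLeft (fun _ : Fin m => ℝ) e y = y ⬝ᵥ y := fun y => by
    rw [dotProduct, ← Equiv.sum_comp e]
    simp only [he]; rfl
  have hj : ∀ y : Fin m → ℝ, MeasurableEquiv.piCongrLeft (fun _ : Fin m => ℝ) e y j = y i :=
    fun y => by simpa [e] using he y i
  simpa only [hd, hj] using h

theorem integrable_radial_mul_mul {K : ℝ → ℝ}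
    (hK : Integrable fun y : Fin m → ℝ => K (y ⬝ᵥ y) * (y ⬝ᵥ y)) (i j : Fin m) :
    Integrable fun y : Fin m → ℝ => K (y ⬝ᵥ y) * (y i * y j) := by
  -- Measurability of `K` is not assumed: the integrand is an integrable function
  -- times a bounded one.
  have h := hK.mul_bdd (c := 1) (g := fun y : Fin m → ℝ => y i * y j / (y ⬝ᵥ y))
    (Measurable.aestronglyMeasurable (by unfold dotProduct; fun_prop))
    (Eventually.of_forall fun y => by
      have h0 : 0 ≤ y ⬝ᵥ y := (abs_nonneg _).trans (abs_mul_le_dotProduct_self y i j)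
      rw [Real.norm_eq_abs, abs_div, abs_of_nonneg h0]
      exact div_le_one_of_le₀ (abs_mul_le_dotProduct_self y i j) h0)
  refine h.congr (Eventually.of_forall fun y => ?_)
  by_cases hy : y = 0
  · simp [hy]
  · have := (dotProduct_self_pos hy).ne'
    field_simp

/-- The second moments of a spherically symmetric weight are proportional to the identity. -/
theorem integral_radial_mul_quadratic [NeZero m] {K : ℝ → ℝ}
    (hK : Integrable fun y : Fin m → ℝ => K (y ⬝ᵥ y) * (y ⬝ᵥ y)) (A : Matrix (Fin m) (Fin m) ℝ) :
    ∫ y : Fin m → ℝ, K (y ⬝ᵥ y) * (y ⬝ᵥ A.mulVec y) =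
      A.trace / m * ∫ y : Fin m → ℝ, K (y ⬝ᵥ y) * (y ⬝ᵥ y) := by
  have hsum : ∀ B : Matrix (Fin m) (Fin m) ℝ, ∫ y : Fin m → ℝ, K (y ⬝ᵥ y) * (y ⬝ᵥ B.mulVec y) =
      B.trace * ∫ y : Fin m → ℝ, K (y ⬝ᵥ y) * (y 0 * y 0) := by
    intro B
    have e : ∀ y : Fin m → ℝ, K (y ⬝ᵥ y) * (y ⬝ᵥ B.mulVec y) =
        ∑ i, ∑ j, B i j * (K (y ⬝ᵥ y) * (y i * y j)) := fun y => by
      simp only [dotProduct, Matrix.mulVec, Finset.mul_sum]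
      exact Finset.sum_congr rfl fun i _ => Finset.sum_congr rfl fun j _ => by ring
    simp only [e]
    have hint : ∀ i j, Integrable fun y : Fin m → ℝ => B i j * (K (y ⬝ᵥ y) * (y i * y j)) :=
      fun i j => (integrable_radial_mul_mul hK i j).const_mul _
    rw [integral_finsetSum _ fun i _ => integrable_finsetSum _ fun j _ => hint i j, Matrix.trace,
      Finset.sum_mul]
    refine Finset.sum_congr rfl fun i _ => ?_
    rw [integral_finsetSum _ fun j _ => hint i j, Finset.sum_eq_single i, integral_const_mul,
      integral_radial_mul_mul_self K i 0, Matrix.diag_apply]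
    · intro j _ hj
      rw [integral_const_mul, integral_radial_mul_mul_of_ne K hj.symm, mul_zero]
    · simp
  have h1 := hsum 1
  rw [Matrix.trace_one, Fintype.card_fin] at h1
  simp only [Matrix.one_mulVec] at h1
  rw [hsum A, h1]
  have : (m : ℝ) ≠ 0 := NeZero.ne _
  field_simp

theorem integral_radial_mul_linear (K : ℝ → ℝ) (ℓ : Fin m → ℝ) :
    ∫ y : Fin m → ℝ, K (y ⬝ᵥ y) * (ℓ ⬝ᵥ y) = 0 := by
  have h := integral_neg_eq_self (fun y : Fin m → ℝ => K (y ⬝ᵥ y) * (ℓ ⬝ᵥ y)) volume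
  simp only [dotProduct_neg, neg_dotProduct, neg_neg, mul_neg, integral_neg] at h
  linarith

end Spherical

/-! ### Density generators and integration by parts -/

section Generator
open Filter Topology

variable {m : ℕ} {g : ℝ → ℝ}

theorem IsRegularGenerator.hasDerivAt (hr : IsRegularGenerator m g) {t : ℝ} (ht : 0 < t) :
    HasDerivAt g (deriv g t) t :=
  ((hr.contDiffOn.differentiableOn one_ne_zero).differentiableAt (Ioi_mem_nhds ht)).hasDerivAt

/-- A nonnegative generator has derivative zero wherever it vanishes. -/
theorem mul_inv_mul_deriv_of_nonneg (hg : ∀ t, 0 < t → 0 ≤ g t) {t : ℝ} (ht : 0 < t) :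
    g t * ((g t)⁻¹ * deriv g t) = deriv g t := by
  by_cases h : g t = 0
  -- A zero of a nonnegative function is a minimum.
  · have : IsLocalMin g t := by
      filter_upwards [Ioi_mem_nhds ht] with s hs
      rw [h]; exact hg s hs
    rw [this.deriv_eq_zero]; simp
  · field_simp

theorem IsRegularGenerator.measurable_indicator (hr : IsRegularGenerator m g) :
    Measurable ((Ioi (0 : ℝ)).indicator g) := by
  have := hr.contDiffOn.continuousOn.measurable_piecewise (g := fun _ => (0 : ℝ))
    continuousOn_const measurableSet_Ioi
  rwa [show (Ioi (0 : ℝ)).piecewise g (fun _ => 0) = (Ioi (0 : ℝ)).indicator g from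
    piecewise_eq_indicator] at this

theorem indicator_dotProduct_self {y : Fin m → ℝ} (hy : y ≠ 0) :
    (Ioi (0 : ℝ)).indicator g (y ⬝ᵥ y) = g (y ⬝ᵥ y) :=
  indicator_of_mem (mem_Ioi.2 (dotProduct_self_pos hy)) g

theorem measurable_dotProduct_self : Measurable fun y : Fin m → ℝ => y ⬝ᵥ y := by
  unfold dotProduct; fun_prop

theorem IsRegularGenerator.aemeasurable_radial [NeZero m] (hr : IsRegularGenerator m g) :
    AEMeasurable fun y : Fin m → ℝ => g (y ⬝ᵥ y) :=
  ⟨_, hr.measurable_indicator.comp measurable_dotProduct_self, by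
    filter_upwards [Measure.ae_ne volume (0 : Fin m → ℝ)] with y hy
    exact (indicator_dotProduct_self hy).symm⟩

/-- Where `t^(m/2-1) g(t)` is integrable, so is `t^(m/2) g'(t)`, by the Cauchy-Schwarz inequality
and the finiteness of `∫ t^(m/2+1) g'(t)² / g(t) dt`. -/
theorem IsRegularGenerator.integrableOn_deriv (hr : IsRegularGenerator m g)
    (hg : g ∈ densityGenerators m) :
    IntegrableOn (fun t => t ^ ((m : ℝ) / 2) * deriv g t) (Ioi 0) := by
  refine (hr.integrable_alpha.add hg.2.1).mono'
    (Measurable.aestronglyMeasurable (by have := measurable_deriv g; fun_prop)) ?_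
  filter_upwards [ae_restrict_mem measurableSet_Ioi] with t ht
  have ht' : 0 < t := ht
  have e := mul_inv_mul_deriv_of_nonneg hg.1 ht'
  have h0 := hg.1 t ht'
  set a := (g t)⁻¹ * deriv g t
  have e1 : (g t)⁻¹ * deriv g t ^ 2 = a ^ 2 * g t := by
    rw [show (g t)⁻¹ * deriv g t ^ 2 = a * deriv g t by ring, ← e]; ring
  have hp : t ^ ((m : ℝ) / 2) = t * t ^ ((m : ℝ) / 2 - 1) := by
    rw [Real.rpow_sub_one ht'.ne']; field_simp
  have hp1 : t ^ ((m : ℝ) / 2 + 1) = t ^ 2 * t ^ ((m : ℝ) / 2 - 1) := by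
    rw [Real.rpow_add_one ht'.ne', hp]; ring
  have hq : 0 < t ^ ((m : ℝ) / 2 - 1) := Real.rpow_pos_of_pos ht' _
  simp only [Pi.add_apply]
  rw [e1, ← e, hp, hp1, Real.norm_eq_abs]
  have h1 : |t * t ^ ((m : ℝ) / 2 - 1) * (g t * a)| =
      t ^ ((m : ℝ) / 2 - 1) * g t * (t * |a|) := by
    rw [abs_mul, abs_mul, abs_mul, abs_of_pos ht', abs_of_pos hq, abs_of_nonneg h0]; ring
  -- What remains is `t |a| ≤ (t |a|)² + 1`.
  have h2 : t ^ 2 * t ^ ((m : ℝ) / 2 - 1) * (a ^ 2 * g t) + t ^ ((m : ℝ) / 2 - 1) * g t =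
      t ^ ((m : ℝ) / 2 - 1) * g t * ((t * |a|) ^ 2 + 1) := by
    linear_combination (-(t ^ ((m : ℝ) / 2 - 1) * g t * t ^ 2)) * sq_abs a
  rw [h1, h2]
  refine mul_le_mul_of_nonneg_left ?_ (mul_nonneg hq.le h0)
  nlinarith [sq_nonneg (t * |a| - 1 / 2)]

/-- Integration by parts. The boundary terms vanish since, in the variable `log t`, both
`t^(m/2) g(t)` and its derivative are integrable. -/
theorem IsRegularGenerator.integral_deriv (hr : IsRegularGenerator m g)
    (hg : g ∈ densityGenerators m) :
    ∫ t in Ioi (0 : ℝ), t ^ ((m : ℝ) / 2) * deriv g t =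
      -((m : ℝ) / 2) * ∫ t in Ioi (0 : ℝ), t ^ ((m : ℝ) / 2 - 1) * g t := by
  set u' : ℝ → ℝ := fun t => (m : ℝ) / 2 * (t ^ ((m : ℝ) / 2 - 1) * g t) +
    t ^ ((m : ℝ) / 2) * deriv g t with hu'
  have hint1 : IntegrableOn (fun t => (m : ℝ) / 2 * (t ^ ((m : ℝ) / 2 - 1) * g t)) (Ioi 0) :=
    hg.2.1.const_mul _
  have hu'int : IntegrableOn u' (Ioi 0) := hint1.add (hr.integrableOn_deriv hg)
  have hexp : ∀ x ∈ (univ : Set ℝ), HasDerivWithinAt Real.exp (Real.exp x) univ x := fun x _ =>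
    (Real.hasDerivAt_exp x).hasDerivWithinAt
  have himg : Real.exp '' univ = Ioi 0 := by rw [image_univ, Real.range_exp]
  have h1 := integrableOn_image_iff_integrableOn_abs_deriv_smul MeasurableSet.univ hexp
    Real.exp_injective.injOn u'
  have h2 := integral_image_eq_integral_abs_deriv_smul MeasurableSet.univ hexp
    Real.exp_injective.injOn u'
  have h3 := integrableOn_image_iff_integrableOn_abs_deriv_smul MeasurableSet.univ hexp
    Real.exp_injective.injOn (fun t => t ^ ((m : ℝ) / 2 - 1) * g t)
  simp only [himg, integrableOn_univ, Measure.restrict_univ, abs_of_pos (Real.exp_pos _),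
    smul_eq_mul] at h1 h2 h3
  have hder : ∀ x : ℝ, HasDerivAt
      (fun x => Real.exp x * (Real.exp x ^ ((m : ℝ) / 2 - 1) * g (Real.exp x)))
      (Real.exp x * u' (Real.exp x)) x := by
    intro x
    have hx := Real.exp_pos x
    have ht : HasDerivAt (fun t => t ^ ((m : ℝ) / 2) * g t) (u' (Real.exp x)) (Real.exp x) := by
      refine ((Real.hasDerivAt_rpow_const (Or.inl hx.ne')).mul (hr.hasDerivAt hx)).congr_deriv ?_
      rw [hu']; ring
    have hc := ht.comp x (Real.hasDerivAt_exp x)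
    refine (hc.congr_of_eventuallyEq (Eventually.of_forall fun z => ?_)).congr_deriv (mul_comm _ _)
    have hz := Real.exp_pos z
    simp only [Function.comp_apply, Real.rpow_sub_one hz.ne']
    field_simp
  have h4 := integral_eq_zero_of_hasDerivAt_of_integrable hder (h1.1 hu'int) (h3.1 hg.2.1)
  rw [h4, hu', integral_add hint1 (hr.integrableOn_deriv hg), integral_const_mul] at h2
  linarith

end Generator

/-! ### Scores under a spherical law -/

section SphericalLaw
open Filter Topology

variable {m : ℕ} [NeZero m] {g : ℝ → ℝ}

/-- The spherical law with generator `g`: the member of the elliptical family with location `0` and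
scatter matrix `I`. -/
def sphericalLaw (m : ℕ) (g : ℝ → ℝ) : Measure (Fin m → ℝ) :=
  densityLaw fun y => g (y ⬝ᵥ y)

theorem ae_toReal_ofReal_radial (hg : ∀ t, 0 < t → 0 ≤ g t) :
    ∀ᵐ y : Fin m → ℝ, (ENNReal.ofReal (g (y ⬝ᵥ y))).toReal = g (y ⬝ᵥ y) := by
  filter_upwards [Measure.ae_ne volume (0 : Fin m → ℝ)] with y hy
  exact ENNReal.toReal_ofReal (hg _ (dotProduct_self_pos hy))

theorem integral_sphericalLaw (hr : IsRegularGenerator m g) (hg : ∀ t, 0 < t → 0 ≤ g t)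
    (f : (Fin m → ℝ) → ℝ) : ∫ y, f y ∂sphericalLaw m g = ∫ y, g (y ⬝ᵥ y) * f y := by
  unfold sphericalLaw densityLaw
  rw [integral_withDensity_eq_integral_toReal_smul₀ hr.aemeasurable_radial.ennreal_ofReal
    (Eventually.of_forall fun _ => ENNReal.ofReal_lt_top)]
  refine integral_congr_ae ?_
  filter_upwards [ae_toReal_ofReal_radial hg] with y hy
  rw [hy, smul_eq_mul]

theorem integrable_sphericalLaw_iff (hr : IsRegularGenerator m g) (hg : ∀ t, 0 < t → 0 ≤ g t)
    (f : (Fin m → ℝ) → ℝ) :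
    Integrable f (sphericalLaw m g) ↔ Integrable fun y => g (y ⬝ᵥ y) * f y := by
  unfold sphericalLaw densityLaw
  rw [integrable_withDensity_iff_integrable_smul₀' hr.aemeasurable_radial.ennreal_ofReal
    (Eventually.of_forall fun _ => ENNReal.ofReal_lt_top)]
  refine integrable_congr ?_
  filter_upwards [ae_toReal_ofReal_radial hg] with y hy
  rw [hy, smul_eq_mul]

theorem ae_sphericalLaw (hr : IsRegularGenerator m g) :
    ∀ᵐ y ∂sphericalLaw m g, y ≠ 0 ∧ 0 < g (y ⬝ᵥ y) := by
  unfold sphericalLaw densityLaw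
  rw [ae_withDensity_iff' hr.aemeasurable_radial.ennreal_ofReal]
  filter_upwards [Measure.ae_ne volume (0 : Fin m → ℝ)] with y hy h
  exact ⟨hy, by simpa using h⟩

theorem isFiniteMeasure_sphericalLaw (hg : g ∈ densityGenerators m) :
    IsFiniteMeasure (sphericalLaw m g) :=
  isFiniteMeasure_withDensity_ofReal ((integrable_radial_iff g).2 hg.2.1).hasFiniteIntegral

theorem aestronglyMeasurable_logDeriv_radial (hr : IsRegularGenerator m g) :
    AEStronglyMeasurable (fun y => (g (y ⬝ᵥ y))⁻¹ * deriv g (y ⬝ᵥ y)) (sphericalLaw m g) := by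
  refine AEMeasurable.aestronglyMeasurable (AEMeasurable.mono_ac ?_
    (withDensity_absolutelyContinuous _ _))
  exact hr.aemeasurable_radial.inv.mul
    ((measurable_deriv g).comp measurable_dotProduct_self).aemeasurable

/-- If `w(t)²` shifts the exponent `m / 2 - 1` to `p`, then `E[w(Q)² (g'(Q) / g(Q))²]` is a
multiple of `∫ t^p g'(t)² / g(t) dt`. -/
theorem memLp_radial_mul {w : ℝ → ℝ} (hw : Measurable w) (hr : IsRegularGenerator m g)
    (hg : g ∈ densityGenerators m) {p : ℝ}
    (hp : ∀ t, 0 < t → t ^ ((m : ℝ) / 2 - 1) * w t ^ 2 = t ^ p)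
    (hint : IntegrableOn (fun t => t ^ p * ((g t)⁻¹ * deriv g t ^ 2)) (Ioi 0)) :
    MemLp (fun y => (g (y ⬝ᵥ y))⁻¹ * deriv g (y ⬝ᵥ y) * w (y ⬝ᵥ y)) 2 (sphericalLaw m g) := by
  have hmeas : AEStronglyMeasurable
      (fun y => (g (y ⬝ᵥ y))⁻¹ * deriv g (y ⬝ᵥ y) * w (y ⬝ᵥ y)) (sphericalLaw m g) :=
    (aestronglyMeasurable_logDeriv_radial hr).mul
      (hw.comp measurable_dotProduct_self).aestronglyMeasurable
  rw [memLp_two_iff_integrable_sq hmeas, integrable_sphericalLaw_iff hr hg.1,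
    integrable_radial_iff (fun t => g t * ((g t)⁻¹ * deriv g t * w t) ^ 2)]
  refine (integrableOn_congr_fun (fun t ht => ?_) measurableSet_Ioi).1 hint
  have e := mul_inv_mul_deriv_of_nonneg hg.1 (mem_Ioi.1 ht)
  rw [← hp t ht]
  linear_combination (-(t ^ ((m : ℝ) / 2 - 1) * w t ^ 2 * ((g t)⁻¹ * deriv g t))) * e

/-- `E[Q² φ(Q)²] < ∞`. -/
theorem memLp_radial_mul_self (hr : IsRegularGenerator m g) (hg : g ∈ densityGenerators m) :
    MemLp (fun y => (g (y ⬝ᵥ y))⁻¹ * deriv g (y ⬝ᵥ y) * (y ⬝ᵥ y)) 2 (sphericalLaw m g) := by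
  refine memLp_radial_mul (w := id) measurable_id hr hg (fun t ht => ?_) hr.integrable_alpha
  rw [show (m : ℝ) / 2 + 1 = (m : ℝ) / 2 - 1 + (2 : ℕ) by push_cast; ring,
    Real.rpow_add_natCast ht.ne', id]

/-- `E[Q φ(Q)²] < ∞`. -/
theorem memLp_radial_mul_sqrt (hr : IsRegularGenerator m g) (hg : g ∈ densityGenerators m) :
    MemLp (fun y => (g (y ⬝ᵥ y))⁻¹ * deriv g (y ⬝ᵥ y) * √(y ⬝ᵥ y)) 2 (sphericalLaw m g) := by
  refine memLp_radial_mul (w := Real.sqrt) Real.continuous_sqrt.measurable hr hg (fun t ht => ?_)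
    hr.integrable_beta
  rw [Real.sq_sqrt ht.le, ← Real.rpow_add_one ht.ne', sub_add_cancel]

theorem memLp_radial_quadratic (hr : IsRegularGenerator m g) (hg : g ∈ densityGenerators m)
    (A : Matrix (Fin m) (Fin m) ℝ) :
    MemLp (fun y => (g (y ⬝ᵥ y))⁻¹ * deriv g (y ⬝ᵥ y) * (y ⬝ᵥ A.mulVec y)) 2
      (sphericalLaw m g) := by
  have h : ∀ i j, MemLp (fun y : Fin m → ℝ => (g (y ⬝ᵥ y))⁻¹ * deriv g (y ⬝ᵥ y) * (y i * y j)) 2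
      (sphericalLaw m g) := fun i j => by
    refine (memLp_radial_mul_self hr hg).mono ((aestronglyMeasurable_logDeriv_radial hr).mul
      (Measurable.aestronglyMeasurable (by fun_prop))) (Eventually.of_forall fun y => ?_)
    rw [norm_mul, norm_mul _ (y ⬝ᵥ y)]
    exact mul_le_mul_of_nonneg_left
      ((abs_mul_le_dotProduct_self y i j).trans (le_abs_self _)) (norm_nonneg _)
  have hs := memLp_finsetSum Finset.univ fun i _ =>
    memLp_finsetSum Finset.univ fun j _ => (h i j).const_mul (A i j)
  refine (memLp_congr_ae (Eventually.of_forall fun y => ?_)).1 hs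
  simp only [dotProduct, Matrix.mulVec, Finset.mul_sum]
  exact Finset.sum_congr rfl fun i _ => Finset.sum_congr rfl fun j _ => by ring

theorem memLp_radial_linear (hr : IsRegularGenerator m g) (hg : g ∈ densityGenerators m)
    (ℓ : Fin m → ℝ) :
    MemLp (fun y => (g (y ⬝ᵥ y))⁻¹ * deriv g (y ⬝ᵥ y) * (ℓ ⬝ᵥ y)) 2 (sphericalLaw m g) := by
  have h : ∀ i, MemLp (fun y : Fin m → ℝ => (g (y ⬝ᵥ y))⁻¹ * deriv g (y ⬝ᵥ y) * y i) 2
      (sphericalLaw m g) := fun i => by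
    refine (memLp_radial_mul_sqrt hr hg).mono ((aestronglyMeasurable_logDeriv_radial hr).mul
      (Measurable.aestronglyMeasurable (by fun_prop))) (Eventually.of_forall fun y => ?_)
    rw [norm_mul, norm_mul _ (√(y ⬝ᵥ y)), Real.norm_of_nonneg (Real.sqrt_nonneg _)]
    refine mul_le_mul_of_nonneg_left (Real.abs_le_sqrt ?_) (norm_nonneg _)
    rw [sq]
    exact (le_abs_self _).trans (abs_mul_le_dotProduct_self y i i)
  have hs := memLp_finsetSum Finset.univ fun i _ => (h i).const_mul (ℓ i)
  refine (memLp_congr_ae (Eventually.of_forall fun y => ?_)).1 hs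
  simp only [dotProduct, Finset.mul_sum]
  exact Finset.sum_congr rfl fun i _ => by ring

theorem memLp_affineScore (hr : IsRegularGenerator m g) (hg : g ∈ densityGenerators m)
    (A : Matrix (Fin m) (Fin m) ℝ) (ℓ : Fin m → ℝ) :
    MemLp (affineScore g A ℓ) 2 (sphericalLaw m g) := by
  have := isFiniteMeasure_sphericalLaw hg
  refine (memLp_congr_ae (Eventually.of_forall fun y => ?_)).1
    ((memLp_const (-(1 / 2) * A.trace)).sub
      ((memLp_radial_quadratic hr hg A).add (memLp_radial_linear hr hg ℓ)))
  simp only [affineScore, Pi.sub_apply, Pi.add_apply]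
  ring

theorem integral_sphericalLaw_quadratic (hr : IsRegularGenerator m g)
    (hg : g ∈ densityGenerators m) {K : ℝ → ℝ}
    (hK : Integrable (fun y => K (y ⬝ᵥ y) * (y ⬝ᵥ y)) (sphericalLaw m g))
    (A : Matrix (Fin m) (Fin m) ℝ) :
    ∫ y, K (y ⬝ᵥ y) * (y ⬝ᵥ A.mulVec y) ∂sphericalLaw m g =
      A.trace / m * ∫ y, K (y ⬝ᵥ y) * (y ⬝ᵥ y) ∂sphericalLaw m g := by
  rw [integrable_sphericalLaw_iff hr hg.1] at hK
  rw [integral_sphericalLaw hr hg.1, integral_sphericalLaw hr hg.1]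
  simp only [← mul_assoc] at hK ⊢
  exact integral_radial_mul_quadratic (K := fun t => g t * K t) hK A

theorem integral_sphericalLaw_linear (hr : IsRegularGenerator m g)
    (hg : g ∈ densityGenerators m) (K : ℝ → ℝ) (ℓ : Fin m → ℝ) :
    ∫ y, K (y ⬝ᵥ y) * (ℓ ⬝ᵥ y) ∂sphericalLaw m g = 0 := by
  rw [integral_sphericalLaw hr hg.1]
  simp only [← mul_assoc]
  exact integral_radial_mul_linear (fun t => g t * K t) ℓ

/-- `E[Q φ(Q)] = m`, in the form `E[Q g'(Q) / g(Q)] = -m / 2`. -/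
theorem integral_logDeriv_mul_self (hr : IsRegularGenerator m g) (hg : g ∈ densityGenerators m) :
    ∫ y, (g (y ⬝ᵥ y))⁻¹ * deriv g (y ⬝ᵥ y) * (y ⬝ᵥ y) ∂sphericalLaw m g =
      -((m : ℝ) / 2) * (sphericalLaw m g).real univ := by
  obtain ⟨c, hc⟩ := exists_integral_radial m
  have h1 : (sphericalLaw m g).real univ = ∫ y : Fin m → ℝ, g (y ⬝ᵥ y) := by
    have := integral_sphericalLaw hr hg.1 fun _ => (1 : ℝ)
    simpa using this
  rw [h1, hc g, integral_sphericalLaw hr hg.1, hc fun t => g t * ((g t)⁻¹ * deriv g t * t)]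
  have h2 : ∫ t in Ioi (0 : ℝ), t ^ ((m : ℝ) / 2 - 1) * (g t * ((g t)⁻¹ * deriv g t * t)) =
      ∫ t in Ioi (0 : ℝ), t ^ ((m : ℝ) / 2) * deriv g t := by
    refine setIntegral_congr_fun measurableSet_Ioi fun t ht => ?_
    have ht' : 0 < t := ht
    have e := mul_inv_mul_deriv_of_nonneg hg.1 ht'
    have hp : t ^ ((m : ℝ) / 2) = t * t ^ ((m : ℝ) / 2 - 1) := by
      rw [Real.rpow_sub_one ht'.ne']; field_simp
    simp only [hp]
    linear_combination t ^ ((m : ℝ) / 2 - 1) * t * e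
  rw [h2, hr.integral_deriv hg]
  ring

/-- The location and scatter scores have finite variance and mean zero. -/
theorem isCentered_affineScore (hr : IsRegularGenerator m g) (hg : g ∈ densityGenerators m)
    (A : Matrix (Fin m) (Fin m) ℝ) (ℓ : Fin m → ℝ) :
    IsCentered (sphericalLaw m g) (affineScore g A ℓ) := by
  have := isFiniteMeasure_sphericalLaw hg
  have hL := memLp_affineScore hr hg A ℓ
  refine ⟨hL, hL.integrable one_le_two, ?_⟩
  have hq := (memLp_radial_quadratic hr hg A).integrable one_le_two
  have hl := (memLp_radial_linear hr hg ℓ).integrable one_le_two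
  have hs := (memLp_radial_mul_self hr hg).integrable one_le_two
  simp only [affineScore, mul_add]
  rw [integral_sub (integrable_const _) (hq.fun_add hl), integral_add hq hl,
    integral_sphericalLaw_quadratic hr hg (K := fun t => (g t)⁻¹ * deriv g t) hs,
    integral_sphericalLaw_linear hr hg (fun t => (g t)⁻¹ * deriv g t),
    integral_logDeriv_mul_self hr hg, integral_const, smul_eq_mul]
  have : (m : ℝ) ≠ 0 := NeZero.ne _
  field_simp
  ring

/-- The part of the score in the direction `(A, ℓ)` that remains after subtracting the multiple
`tr A / m` of the scale score (`A = I`, `ℓ = 0`) is orthogonal to every function of the radius. -/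
theorem integral_affineScore_sub_mul_radial (hr : IsRegularGenerator m g)
    (hg : g ∈ densityGenerators m) (A : Matrix (Fin m) (Fin m) ℝ) (ℓ : Fin m → ℝ) {H : ℝ → ℝ}
    (hH : MemLp (fun y => H (y ⬝ᵥ y)) 2 (sphericalLaw m g)) :
    ∫ y, (affineScore g A ℓ y - A.trace / m * affineScore g 1 0 y) * H (y ⬝ᵥ y)
      ∂sphericalLaw m g = 0 := by
  have hm : (m : ℝ) ≠ 0 := NeZero.ne _
  set K : ℝ → ℝ := fun t => (g t)⁻¹ * deriv g t * H t with hK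
  have mk : ∀ {f : (Fin m → ℝ) → ℝ},
      MemLp (fun y => (g (y ⬝ᵥ y))⁻¹ * deriv g (y ⬝ᵥ y) * f y) 2 (sphericalLaw m g) →
      Integrable (fun y => K (y ⬝ᵥ y) * f y) (sphericalLaw m g) := fun hf =>
    (hf.integrable_mul hH).congr (Eventually.of_forall fun y => by
      simp only [hK, Pi.mul_apply]; ring)
  have hs := mk (memLp_radial_mul_self hr hg)
  have hq := mk (memLp_radial_quadratic hr hg A)
  have hl := mk (memLp_radial_linear hr hg ℓ)
  have e : ∀ y, (affineScore g A ℓ y - A.trace / m * affineScore g 1 0 y) * H (y ⬝ᵥ y) =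
      A.trace / m * (K (y ⬝ᵥ y) * (y ⬝ᵥ y)) -
        (K (y ⬝ᵥ y) * (y ⬝ᵥ A.mulVec y) + K (y ⬝ᵥ y) * (ℓ ⬝ᵥ y)) := fun y => by
    simp only [affineScore, hK, Matrix.trace_one, Fintype.card_fin, Matrix.one_mulVec,
      zero_dotProduct, add_zero]
    field_simp
    ring
  simp only [e]
  rw [integral_sub (hs.const_mul _) (hq.fun_add hl), integral_add hq hl, integral_const_mul,
    integral_sphericalLaw_quadratic hr hg hs, integral_sphericalLaw_linear hr hg K]
  ring

end SphericalLaw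

/-! ### Efficient scores in the Hilbert space of centered functions -/

section Hilbert
open Filter Topology

variable {X : Type*} [MeasureSpace X] {ι κ : Type*} [DecidableEq ι] [DecidableEq κ]

theorem IsCentered.congr {P : Measure X} {f f' : X → ℝ} (h : IsCentered P f) (hff : f =ᵐ[P] f') :
    IsCentered P f' :=
  ⟨(memLp_congr_ae hff).1 h.1, (integrable_congr hff).1 h.2.1,
    (integral_congr_ae hff).symm.trans h.2.2⟩

theorem isCentered_comp_iff {Y : Type*} [MeasureSpace Y] {ν : Measure Y} {P : Measure X}
    {T : Y → X} (hT : MeasurePreserving T ν P) (hemb : MeasurableEmbedding T) {f : X → ℝ} :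
    IsCentered ν (f ∘ T) ↔ IsCentered P f := by
  unfold IsCentered
  rw [hT.integrable_comp_emb hemb, ← hemb.memLp_map_measure_iff, hT.map_eq]
  simp only [Function.comp_apply, hT.integral_comp hemb f]

theorem coe_toCentered {P : Measure X} {f : X → ℝ} (hf : IsCentered P f) :
    ((toCentered P f : Lp ℝ 2 P) : X → ℝ) =ᵐ[P] f := by
  rw [toCentered, dif_pos hf]
  exact hf.1.coeFn_toLp

theorem inner_toCentered {P : Measure X} {f h : X → ℝ} (hf : IsCentered P f)
    (hh : IsCentered P h) : inner ℝ (toCentered P f) (toCentered P h) = ∫ x, f x * h x ∂P := by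
  rw [Submodule.coe_inner, L2.inner_def]
  refine integral_congr_ae ?_
  filter_upwards [coe_toCentered hf, coe_toCentered hh] with x h1 h2
  rw [h1, h2, real_inner_eq_re_inner, RCLike.inner_apply]
  simp [mul_comm]

theorem inner_sub_smul_toCentered {P : Measure X} {f u h : X → ℝ} (hf : IsCentered P f)
    (hu : IsCentered P u) (hh : IsCentered P h) (c : ℝ) :
    inner ℝ (toCentered P f - c • toCentered P u) (toCentered P h) =
      ∫ x, (f x - c * u x) * h x ∂P := by
  have hfh : Integrable (fun x => f x * h x) P := hf.1.integrable_mul hh.1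
  have huh : Integrable (fun x => u x * h x) P := hu.1.integrable_mul hh.1
  have hc : inner ℝ (c • toCentered P u) (toCentered P h) =
      c * inner ℝ (toCentered P u) (toCentered P h) :=
    real_inner_smul_left (F := CenteredL2 P) _ _ _
  rw [inner_sub_left, hc, inner_toCentered hf hh, inner_toCentered hu hh,
    ← integral_const_mul, ← integral_sub hfh (huh.const_mul c)]
  exact integral_congr_ae (Eventually.of_forall fun x => by ring)

/-- A score that is known in other coordinates: if `T` maps `ν` to the true law and the derivative
of the log-density at `T y` is almost surely `f y`, with `f` centered, then the score is
regular. -/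
theorem hasRegularScore_of_hasDerivAt {Y : Type*} [MeasureSpace Y] {ν : Measure Y} {T : Y → X}
    (hemb : MeasurableEmbedding T) {p : (ι → ℝ) → X → ℝ} {θ₀ : ι → ℝ} {i : ι}
    (hT : MeasurePreserving T ν (densityLaw (p θ₀))) {f : Y → ℝ} (hf : IsCentered ν f)
    (hd : ∀ᵐ y ∂ν, HasDerivAt (fun t => Real.log (p (Function.update θ₀ i t) (T y))) (f y) (θ₀ i)) :
    HasRegularScore p θ₀ i ∧ score p θ₀ i ∘ T =ᵐ[ν] f := by
  have hs : score p θ₀ i ∘ T =ᵐ[ν] f := by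
    filter_upwards [hd] with y hy using hy.deriv
  refine ⟨⟨?_, (isCentered_comp_iff hT hemb).1 (hf.congr hs.symm)⟩, hs⟩
  rw [← hT.map_eq, hemb.ae_map_iff]
  filter_upwards [hd] with y hy using hy.differentiableAt

/-- If, after subtraction of a multiple of one nuisance score, the score for `γ_i` is orthogonal to
all nuisance scores, then the difference is the efficient score. -/
theorem efficientScore_eq [Finite κ] (p : (ι → ℝ) → (κ → ℝ) → X → ℝ) (γ₀ : ι → ℝ) (ξ₀ : κ → ℝ)
    (i : ι) (k₀ : κ) (c : ℝ)
    (h : ∀ k, inner ℝ (toCentered (densityLaw (p γ₀ ξ₀)) (score (fun γ => p γ ξ₀) γ₀ i) -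
      c • toCentered (densityLaw (p γ₀ ξ₀)) (score (p γ₀) ξ₀ k₀))
      (toCentered (densityLaw (p γ₀ ξ₀)) (score (p γ₀) ξ₀ k)) = 0) :
    efficientScore p γ₀ ξ₀ i = toCentered (densityLaw (p γ₀ ξ₀)) (score (fun γ => p γ ξ₀) γ₀ i) -
      c • toCentered (densityLaw (p γ₀ ξ₀)) (score (p γ₀) ξ₀ k₀) := by
  unfold efficientScore
  congr 1
  refine Submodule.eq_starProjection_of_mem_of_inner_eq_zero
    (Submodule.smul_mem _ _ (Submodule.subset_span ⟨k₀, rfl⟩)) fun w hw => ?_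
  refine Submodule.span_induction ?_ (inner_zero_right _) (fun x y _ _ hx hy => ?_)
    (fun a x _ hx => ?_) hw
  · rintro _ ⟨k, rfl⟩
    exact h k
  · rw [inner_add_right, hx, hy, add_zero]
  · rw [inner_smul_right, hx, mul_zero]

/-- Two models of the same law that share their scores for the parameter of interest and one
nuisance score have the same efficient Fisher information, if the shared scores for the parameter
of interest are orthogonal to all nuisance scores up to multiples of the shared nuisance score. -/
theorem efficientFIM_eq_of_inner_eq_zero {κ' : Type*} [DecidableEq κ'] [Finite κ] [Finite κ']
    {p : (ι → ℝ) → (κ → ℝ) → X → ℝ} {p' : (ι → ℝ) → (κ' → ℝ) → X → ℝ} {γ₀ : ι → ℝ} {ξ₀ : κ → ℝ}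
    {ξ₀' : κ' → ℝ} {k₀ : κ} {k₀' : κ'} {P : Measure X} {a : ι → X → ℝ} {u : X → ℝ} {c : ι → ℝ}
    (hP : densityLaw (p γ₀ ξ₀) = P) (hP' : densityLaw (p' γ₀ ξ₀') = P)
    (ha : ∀ i, score (fun γ => p γ ξ₀) γ₀ i = a i) (ha' : ∀ i, score (fun γ => p' γ ξ₀') γ₀ i = a i)
    (hu : score (p γ₀) ξ₀ k₀ = u) (hu' : score (p' γ₀) ξ₀' k₀' = u)
    (h : ∀ i k, inner ℝ (toCentered P (a i) - c i • toCentered P u)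
      (toCentered P (score (p γ₀) ξ₀ k)) = 0)
    (h' : ∀ i k, inner ℝ (toCentered P (a i) - c i • toCentered P u)
      (toCentered P (score (p' γ₀) ξ₀' k)) = 0) :
    efficientFIM p γ₀ ξ₀ = efficientFIM p' γ₀ ξ₀' := by
  obtain rfl : a = fun i => score (fun γ => p γ ξ₀) γ₀ i := funext fun i => (ha i).symm
  subst hu hP
  have key : ∀ (Q : Measure X) (_ : Q = densityLaw (p γ₀ ξ₀)) (e : ι → CenteredL2 Q)
      (_ : ∀ i, e i = toCentered Q (score (fun γ => p γ ξ₀) γ₀ i) -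
        c i • toCentered Q (score (p γ₀) ξ₀ k₀)),
      (Matrix.of fun i j => ∫ x, (e i : Lp ℝ 2 Q) x * (e j : Lp ℝ 2 Q) x ∂Q) =
        efficientFIM p γ₀ ξ₀ := by
    rintro Q rfl e he
    unfold efficientFIM
    simp only [efficientScore_eq p γ₀ ξ₀ _ k₀ _ (h _), he]
  refine (key (densityLaw (p' γ₀ ξ₀')) hP' (efficientScore p' γ₀ ξ₀') fun i => ?_).symm
  rw [efficientScore_eq p' γ₀ ξ₀' i k₀' (c i), ha', hu']
  intro k
  rw [ha', hu', hP']
  exact h' i k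

end Hilbert

/-! ### Standardization of an elliptical law -/

section Standardize
open Filter Topology Matrix

variable {m : ℕ} {g : ℝ → ℝ}

/-- The affine map `y ↦ μ + C y`, which standardizes an elliptical law with location `μ` and scatter
matrix `C Cᵀ`. -/
def locScaleMap (μ : Fin m → ℝ) (C : Matrix (Fin m) (Fin m) ℝ) (y : Fin m → ℝ) : Fin m → ℝ :=
  μ + C *ᵥ y

theorem locScaleMap_sub (μ : Fin m → ℝ) (C : Matrix (Fin m) (Fin m) ℝ) (y : Fin m → ℝ) :
    locScaleMap μ C y - μ = C *ᵥ y := add_sub_cancel_left _ _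

theorem measurable_locScaleMap (μ : Fin m → ℝ) (C : Matrix (Fin m) (Fin m) ℝ) :
    Measurable (locScaleMap μ C) := by
  unfold locScaleMap
  exact (Continuous.measurable (by fun_prop))

theorem measurableEmbedding_locScaleMap (μ : Fin m → ℝ) {C : Matrix (Fin m) (Fin m) ℝ}
    (hC : IsUnit C.det) : MeasurableEmbedding (locScaleMap μ C) := by
  refine MeasurableEquiv.measurableEmbedding (⟨⟨locScaleMap μ C,
    fun x => C⁻¹ *ᵥ (x - μ), fun y => ?_, fun x => ?_⟩, measurable_locScaleMap μ C,
    Continuous.measurable (by dsimp only [Equiv.coe_fn_symm_mk]; fun_prop)⟩ :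
      (Fin m → ℝ) ≃ᵐ (Fin m → ℝ))
  · dsimp only
    rw [locScaleMap_sub, Matrix.mulVec_mulVec, Matrix.nonsing_inv_mul _ hC, Matrix.one_mulVec]
  · dsimp only
    rw [locScaleMap, Matrix.mulVec_mulVec, Matrix.mul_nonsing_inv _ hC, Matrix.one_mulVec]
    abel

theorem map_locScaleMap_volume (μ : Fin m → ℝ) {C : Matrix (Fin m) (Fin m) ℝ}
    (hC : IsUnit C.det) :
    (volume : Measure (Fin m → ℝ)) =
      ENNReal.ofReal |C.det| • Measure.map (locScaleMap μ C) volume := by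
  have h1 : locScaleMap μ C = (fun x => μ + x) ∘ (Matrix.toLin' C) := rfl
  rw [h1, ← Measure.map_map (by fun_prop)
    (LinearMap.continuous_of_finiteDimensional _).measurable,
    Real.map_matrix_volume_pi_eq_smul_volume_pi hC.ne_zero, Measure.map_smul,
    (measurePreserving_add_left volume μ).map_eq, smul_smul, ← ENNReal.ofReal_mul (abs_nonneg _),
    ← abs_mul, mul_inv_cancel₀ hC.ne_zero]
  simp

theorem quadratic_locScaleMap (μ : Fin m → ℝ) {C : Matrix (Fin m) (Fin m) ℝ} (hC : IsUnit C.det)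
    (y : Fin m → ℝ) :
    (locScaleMap μ C y - μ) ⬝ᵥ (C * Cᵀ)⁻¹ *ᵥ (locScaleMap μ C y - μ) = y ⬝ᵥ y := by
  rw [locScaleMap_sub, Matrix.mul_inv_rev, ← Matrix.transpose_nonsing_inv, ← Matrix.mulVec_mulVec,
    Matrix.mulVec_mulVec y, Matrix.nonsing_inv_mul _ hC, Matrix.one_mulVec,
    Matrix.dotProduct_mulVec, Matrix.vecMul_transpose, Matrix.mulVec_mulVec,
    Matrix.nonsing_inv_mul _ hC, Matrix.one_mulVec]

/-- The elliptical law with location `μ` and scatter matrix `C Cᵀ` is the image of the spherical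
law under `y ↦ μ + C y`. -/
theorem measurePreserving_locScaleMap (μ : Fin m → ℝ) {C : Matrix (Fin m) (Fin m) ℝ}
    (hC : IsUnit C.det) {p : (Fin m → ℝ) → ℝ}
    (hp : ∀ x, p x = (C * Cᵀ).det ^ (-(1 / 2 : ℝ)) * g ((x - μ) ⬝ᵥ (C * Cᵀ)⁻¹ *ᵥ (x - μ))) :
    MeasurePreserving (locScaleMap μ C) (sphericalLaw m g) (densityLaw p) := by
  refine ⟨measurable_locScaleMap μ C, ?_⟩
  have hemb := measurableEmbedding_locScaleMap μ hC
  have hdet : (C * Cᵀ).det ^ (-(1 / 2 : ℝ)) = |C.det|⁻¹ := by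
    rw [Matrix.det_mul, Matrix.det_transpose, ← abs_mul_abs_self, Real.rpow_neg (by positivity),
      ← Real.sqrt_eq_rpow, Real.sqrt_mul_self (abs_nonneg _)]
  have hpos : 0 < |C.det| := abs_pos.2 hC.ne_zero
  ext s hs
  have hs' := measurable_locScaleMap μ C hs
  have hcov : ∀ F : (Fin m → ℝ) → ENNReal, ∫⁻ x in s, F x =
      ENNReal.ofReal |C.det| * ∫⁻ y in locScaleMap μ C ⁻¹' s, F (locScaleMap μ C y) := fun F => by
    conv_lhs => rw [map_locScaleMap_volume μ hC]
    rw [Measure.restrict_smul, lintegral_smul_measure, hemb.restrict_map, hemb.lintegral_map,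
      smul_eq_mul]
  rw [Measure.map_apply (measurable_locScaleMap μ C) hs, sphericalLaw, densityLaw, densityLaw,
    withDensity_apply _ hs', withDensity_apply _ hs, hcov]
  simp only [hp, quadratic_locScaleMap μ hC, hdet, ENNReal.ofReal_mul (inv_nonneg.2 hpos.le)]
  rw [lintegral_const_mul' _ _ ENNReal.ofReal_ne_top, ← mul_assoc, ← ENNReal.ofReal_mul hpos.le,
    mul_inv_cancel₀ hpos.ne', ENNReal.ofReal_one, one_mul]

theorem inv_smul_matrix {s : ℝ} (hs : 0 < s) {V : Matrix (Fin m) (Fin m) ℝ} (hV : 0 < V.det) :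
    (s • V)⁻¹ = s⁻¹ • V⁻¹ := by
  refine Matrix.inv_eq_right_inv ?_
  rw [Matrix.smul_mul, Matrix.mul_smul, smul_smul, mul_inv_cancel₀ hs.ne',
    Matrix.mul_nonsing_inv _ (isUnit_iff_ne_zero.2 hV.ne'), one_smul]

/-- An elliptical density in terms of the scatter matrix `s V`. -/
theorem elliptical_eq_scatter {s : ℝ} (hs : 0 < s) {V : Matrix (Fin m) (Fin m) ℝ}
    (hV : 0 < V.det) (z : Fin m → ℝ) :
    s ^ (-((m : ℝ) / 2)) * V.det ^ (-(1 / 2 : ℝ)) * g (s⁻¹ * (z ⬝ᵥ V⁻¹ *ᵥ z)) =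
      (s • V).det ^ (-(1 / 2 : ℝ)) * g (z ⬝ᵥ (s • V)⁻¹ *ᵥ z) := by
  rw [inv_smul_matrix hs hV, Matrix.smul_mulVec, dotProduct_smul, smul_eq_mul, Matrix.det_smul,
    Fintype.card_fin, Real.mul_rpow (by positivity) hV.le, ← Real.rpow_natCast_mul hs.le]
  congr 3
  ring

end Standardize

/-! ### The scores of the elliptical model -/

section Corollary
open Filter Topology Matrix

variable {m : ℕ} [NeZero m] {S : Matrix (Fin m) (Fin m) ℝ → ℝ} {g : ℝ → ℝ}
  {μ₀ : Fin m → ℝ} {V₀ C : Matrix (Fin m) (Fin m) ℝ} {s₀ : ℝ}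

theorem resDensity_elim (μ : Fin m → ℝ) (v : LowerIdx m → ℝ) (s : ℝ) (x : Fin m → ℝ) :
    resDensity S g (Sum.elim μ v) s x =
      s ^ (-((m : ℝ) / 2)) * (shapeMatrix S v).det ^ (-(1 / 2 : ℝ)) *
        g (s⁻¹ * ((x - μ) ⬝ᵥ (shapeMatrix S v)⁻¹ *ᵥ (x - μ))) := rfl

/-- The derivative of the log-density along a path of locations, shape matrices and scales, in the
coordinates in which the true distribution is spherical. -/
theorem hasDerivAt_log_resDensity (hr : IsRegularGenerator m g) {μ : ℝ → Fin m → ℝ}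
    {v : ℝ → LowerIdx m → ℝ} {s : ℝ → ℝ} {M' : Matrix (Fin m) (Fin m) ℝ} {μ' y : Fin m → ℝ}
    {s' t₀ : ℝ} (hμ : ∀ i, HasDerivAt (fun t => μ t i) (μ' i) t₀)
    (hv : ∀ i j, HasDerivAt (fun t => shapeMatrix S (v t) i j) (M' i j) t₀)
    (hs : HasDerivAt s s' t₀) (hV : 0 < (shapeMatrix S (v t₀)).det) (hs0 : 0 < s t₀)
    (hC : IsUnit C.det) (hMC : s t₀ • shapeMatrix S (v t₀) = C * Cᵀ)
    (hy : y ≠ 0) (hpos : 0 < g (y ⬝ᵥ y)) :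
    HasDerivAt (fun t => Real.log (resDensity S g (Sum.elim (μ t) (v t)) (s t)
        (locScaleMap (μ t₀) C y)))
      (affineScore g (C⁻¹ * (s' • shapeMatrix S (v t₀) + s t₀ • M') * C⁻¹ᵀ)
        ((2 : ℝ) • (C⁻¹ *ᵥ μ')) y) t₀ := by
  have h := hasDerivAt_log_elliptical (g := g) (M := fun t => s t • shapeMatrix S (v t))
    (M' := s' • shapeMatrix S (v t₀) + s t₀ • M') (C := C) (y := y) (t₀ := t₀)
    (z := fun t => locScaleMap (μ t₀) C y - μ t) (z' := -μ')
    (fun i j => hs.mul (hv i j)) (fun i => (hμ i).const_sub _) hC hMC (locScaleMap_sub _ _ _)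
    (hr.hasDerivAt (dotProduct_self_pos hy)).differentiableAt hpos.ne'
  rw [Matrix.mulVec_neg, smul_neg, neg_smul, neg_neg] at h
  refine h.congr_of_eventuallyEq ?_
  have hdet : ContinuousAt (fun t => (shapeMatrix S (v t)).det) t₀ :=
    ContinuousAt.comp (g := Matrix.det) continuous_id.matrix_det.continuousAt
      (continuousAt_matrix_of_hasDerivAt hv)
  filter_upwards [hdet.eventually (lt_mem_nhds hV), hs.continuousAt.eventually (lt_mem_nhds hs0)]
    with t ht1 ht2
  rw [resDensity_elim, elliptical_eq_scatter ht2 ht1]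

theorem measurePreserving_resDensity (hS : IsScaleFunction S) (hV₀ : V₀.PosDef) (hSV₀ : S V₀ = 1)
    (hs₀ : 0 < s₀) (hC : IsUnit C.det) (hMC : s₀ • V₀ = C * Cᵀ) :
    MeasurePreserving (locScaleMap μ₀ C) (sphericalLaw m g)
      (densityLaw (resDensity S g (Sum.elim μ₀ (ovecs V₀)) s₀)) :=
  measurePreserving_locScaleMap μ₀ hC fun x => by
    rw [resDensity_elim, hS.shapeMatrix_ovecs hV₀ hSV₀,
      elliptical_eq_scatter hs₀ hV₀.det_pos, hMC]

/-- In the coordinates in which the true distribution is spherical, each score for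
`γ = (μ, ovecs V)` is an affine score. -/
theorem exists_score_location_shape (hS : IsScaleFunction S) (hr : IsRegularGenerator m g)
    (hg : g ∈ densityGenerators m) (hV₀ : V₀.PosDef) (hSV₀ : S V₀ = 1)
    (hs₀ : 0 < s₀) (hC : IsUnit C.det) (hMC : s₀ • V₀ = C * Cᵀ) (i : Fin m ⊕ LowerIdx m) :
    ∃ (A : Matrix (Fin m) (Fin m) ℝ) (ℓ : Fin m → ℝ),
      HasRegularScore (fun γ => resDensity S g γ s₀) (Sum.elim μ₀ (ovecs V₀)) i ∧
      score (fun γ => resDensity S g γ s₀) (Sum.elim μ₀ (ovecs V₀)) i ∘ locScaleMap μ₀ C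
        =ᵐ[sphericalLaw m g] affineScore g A ℓ := by
  have hV : shapeMatrix S (ovecs V₀) = V₀ := hS.shapeMatrix_ovecs hV₀ hSV₀
  have key : ∀ (A : Matrix (Fin m) (Fin m) ℝ) (ℓ : Fin m → ℝ), (∀ y, y ≠ 0 → 0 < g (y ⬝ᵥ y) →
      HasDerivAt (fun t => Real.log (resDensity S g
        (Function.update (Sum.elim μ₀ (ovecs V₀)) i t) s₀ (locScaleMap μ₀ C y)))
        (affineScore g A ℓ y) (Sum.elim μ₀ (ovecs V₀) i)) → _ := fun A ℓ h =>
    hasRegularScore_of_hasDerivAt (measurableEmbedding_locScaleMap μ₀ hC)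
      (p := fun γ => resDensity S g γ s₀) (i := i)
      (measurePreserving_resDensity hS hV₀ hSV₀ hs₀ hC hMC) (isCentered_affineScore hr hg A ℓ)
      ((ae_sphericalLaw hr).mono fun y hy => h y hy.1 hy.2)
  rcases i with i | k
  · have h := fun (y : Fin m → ℝ) (hy : y ≠ 0) (hpos : 0 < g (y ⬝ᵥ y)) =>
      hasDerivAt_log_resDensity (S := S) hr (μ := Function.update μ₀ i)
        (v := fun _ => ovecs V₀) (s := fun _ => s₀) (t₀ := μ₀ i) (M' := 0) (y := y) (C := C)
        (hasDerivAt_pi.1 (hasDerivAt_update μ₀ i (μ₀ i))) (fun _ _ => hasDerivAt_const _ _)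
        (hasDerivAt_const _ _) (by rw [hV]; exact hV₀.det_pos) hs₀ hC (by rw [hV]; exact hMC)
        hy hpos
    simp only [Function.update_eq_self] at h
    simp only [Sum.update_elim_inl, Sum.elim_inl] at key
    exact ⟨_, _, key _ _ h⟩
  · obtain ⟨V', hV'⟩ := hS.exists_hasDerivAt_shapeMatrix hV₀ hSV₀ k
    have h := fun (y : Fin m → ℝ) (hy : y ≠ 0) (hpos : 0 < g (y ⬝ᵥ y)) =>
      hasDerivAt_log_resDensity hr (μ := fun _ => μ₀) (μ' := 0)
        (v := Function.update (ovecs V₀) k) (s := fun _ => s₀) (t₀ := ovecs V₀ k)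
        (fun _ => hasDerivAt_const _ _) hV' (hasDerivAt_const _ _)
        (by rw [Function.update_eq_self, hV]; exact hV₀.det_pos) hs₀ hC
        (by rw [Function.update_eq_self, hV]; exact hMC) hy hpos
    simp only [Sum.update_elim_inr, Sum.elim_inr] at key
    exact ⟨_, _, key _ _ h⟩

/-- In the coordinates in which the true distribution is spherical, the score for the scale is a
radial affine score. -/
theorem score_scale (hS : IsScaleFunction S) (hr : IsRegularGenerator m g)
    (hg : g ∈ densityGenerators m) (hV₀ : V₀.PosDef) (hSV₀ : S V₀ = 1)
    (hs₀ : 0 < s₀) (hC : IsUnit C.det) (hMC : s₀ • V₀ = C * Cᵀ) :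
    HasRegularScore (modelScale S g (Sum.elim μ₀ (ovecs V₀))) (fun _ => s₀) () ∧
      score (modelScale S g (Sum.elim μ₀ (ovecs V₀))) (fun _ => s₀) () ∘ locScaleMap μ₀ C
        =ᵐ[sphericalLaw m g] fun y => s₀⁻¹ * affineScore g 1 0 y := by
  have hV : shapeMatrix S (ovecs V₀) = V₀ := hS.shapeMatrix_ovecs hV₀ hSV₀
  have hA : C⁻¹ * V₀ * C⁻¹ᵀ = s₀⁻¹ • (1 : Matrix (Fin m) (Fin m) ℝ) := by
    have h1 : V₀ = s₀⁻¹ • (C * Cᵀ) := by rw [← hMC, smul_smul, inv_mul_cancel₀ hs₀.ne', one_smul]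
    have h2 : C * Cᵀ * C⁻¹ᵀ = C := by
      rw [Matrix.mul_assoc, ← Matrix.transpose_mul, Matrix.nonsing_inv_mul _ hC,
        Matrix.transpose_one, Matrix.mul_one]
    rw [h1, Matrix.mul_smul, Matrix.smul_mul, Matrix.mul_assoc, h2, Matrix.nonsing_inv_mul _ hC]
  have e : affineScore g (s₀⁻¹ • (1 : Matrix (Fin m) (Fin m) ℝ)) 0 =
      fun y => s₀⁻¹ * affineScore g 1 0 y := by
    funext y
    simp only [affineScore, Matrix.trace_smul, Matrix.smul_mulVec, dotProduct_smul, smul_eq_mul,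
      zero_dotProduct, add_zero]
    ring
  rw [← e]
  have hT : MeasurePreserving (locScaleMap μ₀ C) (sphericalLaw m g)
      (densityLaw (modelScale S g (Sum.elim μ₀ (ovecs V₀)) fun _ => s₀)) :=
    measurePreserving_resDensity hS hV₀ hSV₀ hs₀ hC hMC
  refine hasRegularScore_of_hasDerivAt (p := modelScale S g (Sum.elim μ₀ (ovecs V₀)))
    (measurableEmbedding_locScaleMap μ₀ hC) hT (isCentered_affineScore hr hg _ _)
    ((ae_sphericalLaw hr).mono fun y hy => ?_)
  have h := hasDerivAt_log_resDensity (S := S) hr (μ := fun _ => μ₀) (μ' := 0)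
    (v := fun _ => ovecs V₀) (s := id) (t₀ := s₀) (M' := 0) (y := y) (C := C)
    (fun _ => hasDerivAt_const _ _) (fun _ _ => hasDerivAt_const _ _)
    (hasDerivAt_id _) (by rw [hV]; exact hV₀.det_pos) hs₀ hC (by rw [hV]; exact hMC) hy.1 hy.2
  rw [hV, one_smul, smul_zero, add_zero, hA, Matrix.mulVec_zero, smul_zero] at h
  have e2 : ∀ t, modelScale S g (Sum.elim μ₀ (ovecs V₀)) (Function.update (fun _ => s₀) () t) =
      resDensity S g (Sum.elim μ₀ (ovecs V₀)) t := fun t => by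
    funext x; simp [modelScale]
  simp only [e2]
  exact h

end Corollary

end

/-! ### The comparison of the two information matrices -/

theorem corollary1 {m : ℕ} [NeZero m] (S : Matrix (Fin m) (Fin m) ℝ → ℝ) (hS : IsScaleFunction S)
    {r : ℕ} (Δ : Set (Fin r → ℝ)) (g : (Fin r → ℝ) → ℝ → ℝ)
    (hg : ∀ ζ ∈ Δ, g ζ ∈ constrainedGenerators m)
    (μ₀ : Fin m → ℝ) (V₀ : Matrix (Fin m) (Fin m) ℝ) (hV₀ : V₀.PosDef) (hSV₀ : S V₀ = 1)
    (s₀ : ℝ) (hs₀ : 0 < s₀) (ζ₀ : Fin r → ℝ) (hζ₀ : ζ₀ ∈ interior Δ)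
    (hreg : IsRegularGenerator m (g ζ₀))
    (hscore : ∀ j : Fin r,
      HasRegularScore (modelScaleZeta S g (Sum.elim μ₀ (ovecs V₀)))
        (Sum.elim (fun _ => s₀) ζ₀) (Sum.inr j)) :
    IsRegularModel (modelScale S (g ζ₀)) (Sum.elim μ₀ (ovecs V₀)) (fun _ => s₀) ∧
    IsRegularModel (modelScaleZeta S g) (Sum.elim μ₀ (ovecs V₀)) (Sum.elim (fun _ => s₀) ζ₀) ∧
    efficientFIM (modelScale S (g ζ₀)) (Sum.elim μ₀ (ovecs V₀)) (fun _ => s₀) =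
      efficientFIM (modelScaleZeta S g) (Sum.elim μ₀ (ovecs V₀)) (Sum.elim (fun _ => s₀) ζ₀) := by
  have hgen : g ζ₀ ∈ densityGenerators m := (hg ζ₀ (interior_subset hζ₀)).1
  obtain ⟨C, hMC, hC⟩ := exists_mul_transpose_eq (hV₀.smul hs₀)
  have hV : shapeMatrix S (ovecs V₀) = V₀ := hS.shapeMatrix_ovecs hV₀ hSV₀
  set γ₀ : Fin m ⊕ LowerIdx m → ℝ := Sum.elim μ₀ (ovecs V₀) with hγ₀
  set P : Measure (Fin m → ℝ) := densityLaw (resDensity S (g ζ₀) γ₀ s₀)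
  have hT : MeasurePreserving (locScaleMap μ₀ C) (sphericalLaw m (g ζ₀)) P :=
    measurePreserving_resDensity hS hV₀ hSV₀ hs₀ hC hMC
  have hemb := measurableEmbedding_locScaleMap μ₀ hC
  choose A ℓ hregγ hscoreγ using
    exists_score_location_shape (μ₀ := μ₀) hS hreg hgen hV₀ hSV₀ hs₀ hC hMC
  obtain ⟨hregs, hscores⟩ := score_scale (μ₀ := μ₀) hS hreg hgen hV₀ hSV₀ hs₀ hC hMC
  have hupd : ∀ t, modelScaleZeta S g γ₀
      (Function.update (Sum.elim (fun _ => s₀) ζ₀) (Sum.inl ()) t) =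
      modelScale S (g ζ₀) γ₀ (Function.update (fun _ => s₀) () t) := fun t => by
    rw [Sum.update_elim_inl]; rfl
  have hsc : score (modelScaleZeta S g γ₀) (Sum.elim (fun _ => s₀) ζ₀) (Sum.inl ()) =
      score (modelScale S (g ζ₀) γ₀) (fun _ => s₀) () := by
    funext x
    simp only [score, hupd, Sum.elim_inl]
  have hregs' : HasRegularScore (modelScaleZeta S g γ₀) (Sum.elim (fun _ => s₀) ζ₀)
      (Sum.inl ()) := by
    refine ⟨?_, ?_⟩
    · simp only [hupd]
      exact hregs.1
    · rw [hsc]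
      exact hregs.2
  -- The multiple of the score for `s` to subtract is `s₀ tr A / m`, since the score for `s` is
  -- `s₀⁻¹` times the score in the direction `A = I`.
  have hmain : ∀ (i : Fin m ⊕ LowerIdx m) (h : (Fin m → ℝ) → ℝ) (H : ℝ → ℝ), IsCentered P h →
      h ∘ locScaleMap μ₀ C =ᵐ[sphericalLaw m (g ζ₀)] (fun y => H (y ⬝ᵥ y)) →
      inner ℝ (toCentered P (score (fun γ => resDensity S (g ζ₀) γ s₀) γ₀ i) -
        (s₀ * ((A i).trace / m)) •
          toCentered P (score (modelScale S (g ζ₀) γ₀) (fun _ => s₀) ()))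
        (toCentered P h) = 0 := by
    intro i h H hh hH
    rw [inner_sub_smul_toCentered (hregγ i).2 hregs.2 hh, ← hT.integral_comp hemb,
      ← integral_affineScore_sub_mul_radial hreg hgen (A i) (ℓ i)
        ((memLp_congr_ae hH).1 ((isCentered_comp_iff hT hemb).2 hh).1)]
    refine integral_congr_ae ?_
    filter_upwards [hscoreγ i, hscores, hH] with y h1 h2 h3
    simp only [Function.comp_apply] at h1 h2 h3
    rw [h1, h2, h3]
    field_simp
  have horth : ∀ i, inner ℝ (toCentered P (score (fun γ => resDensity S (g ζ₀) γ s₀) γ₀ i) -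
      (s₀ * ((A i).trace / m)) •
        toCentered P (score (modelScale S (g ζ₀) γ₀) (fun _ => s₀) ()))
      (toCentered P (score (modelScale S (g ζ₀) γ₀) (fun _ => s₀) ())) = 0 := fun i =>
    hmain i _ (fun t => s₀⁻¹ * (-(1 / 2) * (1 : Matrix (Fin m) (Fin m) ℝ).trace -
      (g ζ₀ t)⁻¹ * deriv (g ζ₀) t * t)) hregs.2 (hscores.trans (Filter.Eventually.of_forall
        fun y => by simp [affineScore]))
  refine ⟨⟨hregγ, fun _ => hregs⟩, ⟨hregγ, ?_⟩, ?_⟩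
  · rintro (_ | j)
    · exact hregs'
    · exact hscore j
  · refine efficientFIM_eq_of_inner_eq_zero (k₀ := ()) (k₀' := Sum.inl ()) (P := P)
      (a := score (fun γ => resDensity S (g ζ₀) γ s₀) γ₀)
      (u := score (modelScale S (g ζ₀) γ₀) (fun _ => s₀) ())
      (c := fun i => s₀ * ((A i).trace / m)) rfl rfl (fun _ => rfl) (fun _ => rfl) rfl hsc
      (fun i _ => horth i) fun i k => ?_
    rcases k with _ | j
    · rw [hsc]
      exact horth i
    · -- The density depends on `x` through the quadratic form only, for every value of `ζ`.
      refine hmain i _ (fun q => deriv (fun t => Real.log (s₀ ^ (-((m : ℝ) / 2)) *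
        V₀.det ^ (-(1 / 2 : ℝ)) * g (Function.update ζ₀ j t) q)) (ζ₀ j)) (hscore j).2
        (Filter.Eventually.of_forall fun y => ?_)
      have hQ : s₀⁻¹ * ((locScaleMap μ₀ C y - μ₀) ⬝ᵥ V₀⁻¹.mulVec (locScaleMap μ₀ C y - μ₀)) =
          y ⬝ᵥ y := by
        rw [← quadratic_locScaleMap μ₀ hC y, ← hMC, inv_smul_matrix hs₀ hV₀.det_pos,
          Matrix.smul_mulVec, dotProduct_smul, smul_eq_mul]
      simp only [Function.comp_apply, score, Sum.elim_inr, Sum.update_elim_inr, modelScaleZeta,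
        Sum.elim_inl, hγ₀, resDensity_elim, hV, hQ]
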